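/- Let $G=(V,E)$ be an undirected bipartite graph with $n$ vertices and $m$ edges (parallel edges are allowed), and let $b\in\mathbb{Z}_{\ge 0}^V$ be a demand vector. For a vertex $v$, let $E(v)$ be the set of edges incident to $v$. A fractional $b$-matching is a vector $x\in\mathbb{R}_{\ge 0}^E$ with $\sum_{e\in E(v)}x_e\le b_v$ for every $v\in V$; its size is $\|x\|_1=\sum_{e\in E}x_e$. An integral $b$-matching is such a vector with integer entries, that is, a multiset of edges in which at most $b_v$ edges are incident to $v$, for every $v\in V$. There is an algorithm that, given $G$ as a list of the endpoints of its edges, $b$, and any fractional $b$-matching $x$ in $G$, of size $k=\|x\|_1$, finds an integral $b$-matching in $G$ of size exactly $\lfloor k\rfloor$ in time $\tilde O(m)$, that is, in at most $T(m)$ steps for a function $T(m)=O(m\log^c m)$ with a constant $c$; the bound depends only on $m$. The algorithm is one fixed deterministic program, and it runs on a random access machine with unit-cost instructions and arrays that are initially zero outside the input. The machine has $w$-bit words, for any $w\ge\kappa\log_2(n+m+2)$ with a constant $\kappa$ and such that every $b_v$ is less than $2^w$; on words it can do $+$, $-$, $\cdot$, integer division and comparison. It also stores real numbers, such as the entries of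 $x$, which it can add, subtract, compare, obtain from words, and round down to an integer that fits in a word. -/

import Mathlib

/-! ### Bipartite graphs and b-matchings -/

/-- An undirected graph with vertices `0, …, n - 1` and edges `0, …, m - 1`, parallel edges allowed.
Edge `e` joins `tail e` and `head e`; the order of the two endpoints is arbitrary. -/
structure EdgeGraph (n m : ℕ) where
  tail : Fin m → Fin n
  head : Fin m → Fin n

namespace EdgeGraph

variable {n m : ℕ}

/-- The vertex set splits into `P` and its complement, and every edge has one endpoint in each. -/
def IsBipartite (G : EdgeGraph n m) : Prop :=
  ∃ P : Set (Fin n), ∀ e, (G.tail e ∈ P ∧ G.head e ∉ P) ∨ (G.tail e ∉ P ∧ G.head e ∈ P)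

/-- The set `E(v)` of the edges incident to `v`. -/
def incident (G : EdgeGraph n m) (v : Fin n) : Finset (Fin m) :=
  Finset.univ.filter fun e => G.tail e = v ∨ G.head e = v

/-- A fractional b-matching: a nonnegative real vector, indexed by the edges, whose sum over the
edges incident to `v` is at most `b v`, for every vertex `v`. -/
def IsFractionalBMatching (G : EdgeGraph n m) (b : Fin n → ℕ) (x : Fin m → ℝ) : Prop :=
  (∀ e, 0 ≤ x e) ∧ ∀ v, ∑ e ∈ G.incident v, x e ≤ (b v : ℝ)

/-- An (integral) b-matching: a multiset of edges, given by the multiplicity `y e` of each edge,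
with at most `b v` members incident to `v`, for every vertex `v`. -/
def IsBMatching (G : EdgeGraph n m) (b : Fin n → ℕ) (y : Fin m → ℕ) : Prop :=
  ∀ v, ∑ e ∈ G.incident v, y e ≤ b v

end EdgeGraph

/-! ### A random access machine with words and real numbers

The machine has registers and arrays that hold `w`-bit words (natural numbers below `2 ^ w`), and
registers and arrays that hold real numbers. Every instruction costs one time unit. An operation
whose result is a number that does not fit in a word makes the machine fail. Real numbers can only
be moved, added, subtracted, compared, obtained from a word, and rounded down to a word. The
numbers of registers and arrays are written in the program, so a program uses a fixed, finite
number of them; the position inside an array is the content of a word register. -/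

namespace RealRAM

/-- The instructions. Here `d`, `a`, `c` are numbers of registers, `A` is the number of an array,
and `l` is a line of the program. -/
inductive Instr where
  /-- word register `d` := the number `k` -/
  | const (d k : ℕ)
  /-- word register `d` := word register `a` + word register `c` -/
  | add (d a c : ℕ)
  /-- word register `d` := word register `a` - word register `c`, and `0` if that is negative -/
  | sub (d a c : ℕ)
  /-- word register `d` := word register `a` * word register `c` -/
  | mul (d a c : ℕ)
  /-- word register `d` := word register `a` divided by word register `c`, rounded down -/
  | div (d a c : ℕ)
  /-- word register `d` := entry of word array `A` at the position in word register `a` -/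
  | load (d A a : ℕ)
  /-- entry of word array `A` at the position in word register `a` := word register `c` -/
  | store (A a c : ℕ)
  /-- real register `d` := real register `a` + real register `c` -/
  | radd (d a c : ℕ)
  /-- real register `d` := real register `a` - real register `c` -/
  | rsub (d a c : ℕ)
  /-- real register `d` := word register `a` -/
  | cast (d a : ℕ)
  /-- word register `d` := real register `a` rounded down, and `0` if that is negative -/
  | floor (d a : ℕ)
  /-- real register `d` := entry of real array `A` at the position in word register `a` -/
  | rload (d A a : ℕ)
  /-- entry of real array `A` at the position in word register `a` := real register `c` -/
  | rstore (A a c : ℕ)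
  /-- go to line `l` -/
  | jump (l : ℕ)
  /-- go to line `l` if word register `a` < word register `c` -/
  | jlt (a c l : ℕ)
  /-- go to line `l` if real register `a` < real register `c` -/
  | rjlt (a c l : ℕ)
  /-- stop -/
  | halt

/-- A program is a finite list of instructions; its lines are numbered from `0`. -/
abbrev Program := List Instr

/-- A configuration of the machine. -/
structure State where
  /-- the current line -/
  pc : ℕ
  /-- the word registers -/
  reg : ℕ → ℕ
  /-- the real registers -/
  rreg : ℕ → ℝ
  /-- the word arrays -/
  mem : ℕ → ℕ → ℕ
  /-- the real arrays -/
  rmem : ℕ → ℕ → ℝ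

namespace State

/-- Change one entry of an array. -/
def setEntry {α : Type} (M : ℕ → ℕ → α) (A i : ℕ) (z : α) : ℕ → ℕ → α :=
  Function.update M A (Function.update (M A) i z)

/-- Put a word into a register and go to the next line; fail if the number does not fit. -/
def setReg (s : State) (w d k : ℕ) : Option State :=
  if k < 2 ^ w then some { s with pc := s.pc + 1, reg := Function.update s.reg d k } else none

/-- Put a real number into a register and go to the next line. -/
def setRReg (s : State) (d : ℕ) (z : ℝ) : Option State :=
  some { s with pc := s.pc + 1, rreg := Function.update s.rreg d z }

end State

open Classical in
/-- The effect of one instruction on a machine with `w`-bit words. -/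
noncomputable def exec (w : ℕ) (s : State) : Instr → Option State
  | .const d k => s.setReg w d k
  | .add d a c => s.setReg w d (s.reg a + s.reg c)
  | .sub d a c => s.setReg w d (s.reg a - s.reg c)
  | .mul d a c => s.setReg w d (s.reg a * s.reg c)
  | .div d a c => s.setReg w d (s.reg a / s.reg c)
  | .load d A a => s.setReg w d (s.mem A (s.reg a))
  | .store A a c =>
      some { s with pc := s.pc + 1, mem := State.setEntry s.mem A (s.reg a) (s.reg c) }
  | .radd d a c => s.setRReg d (s.rreg a + s.rreg c)
  | .rsub d a c => s.setRReg d (s.rreg a - s.rreg c)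
  | .cast d a => s.setRReg d (s.reg a : ℝ)
  | .floor d a => s.setReg w d ⌊s.rreg a⌋₊
  | .rload d A a => s.setRReg d (s.rmem A (s.reg a))
  | .rstore A a c =>
      some { s with pc := s.pc + 1, rmem := State.setEntry s.rmem A (s.reg a) (s.rreg c) }
  | .jump l => some { s with pc := l }
  | .jlt a c l => some { s with pc := if s.reg a < s.reg c then l else s.pc + 1 }
  | .rjlt a c l => some { s with pc := if s.rreg a < s.rreg c then l else s.pc + 1 }
  | .halt => none

/-- One step of a program: `none` if it has stopped, has failed, or has left its lines. -/
noncomputable def step (w : ℕ) (prog : Program) (s : State) : Option State :=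
  prog[s.pc]? >>= exec w s

/-- The configuration after exactly `t` steps, if that many steps are possible. -/
noncomputable def run (w : ℕ) (prog : Program) : ℕ → State → Option State
  | 0, s => some s
  | t + 1, s => step w prog s >>= run w prog t

/-- The program has reached an instruction to stop. -/
def Halted (prog : Program) (s : State) : Prop :=
  prog[s.pc]? = some Instr.halt

/-- The first entries of an array are given by `f`, and the others are zero. -/
def toArray {α : Type} [Zero α] {k : ℕ} (f : Fin k → α) (i : ℕ) : α :=
  if h : i < k then f ⟨i, h⟩ else 0

/-- The initial configuration for a graph `G`, demands `b` and an edge vector `x`. The word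
registers `0` and `1` hold the numbers of vertices and edges, the word arrays `0`, `1` and `2` hold
the demands and the two lists of endpoints, the real array `0` holds `x`, and all the rest is
zero. -/
def input {n m : ℕ} (G : EdgeGraph n m) (b : Fin n → ℕ) (x : Fin m → ℝ) : State where
  pc := 0
  reg := fun i => if i = 0 then n else if i = 1 then m else 0
  rreg := fun _ => 0
  mem := fun A =>
    if A = 0 then toArray b
    else if A = 1 then toArray fun e => (G.tail e : ℕ)
    else if A = 2 then toArray fun e => (G.head e : ℕ)
    else fun _ => 0
  rmem := fun A => if A = 0 then toArray x else fun _ => 0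

/-- The vector `y` is written in the word array `3`. -/
def Outputs {m : ℕ} (s : State) (y : Fin m → ℕ) : Prop :=
  ∀ e : Fin m, s.mem 3 e = y e

end RealRAM

/-- `T m = Õ(m)`, that is, `T m = O(m (log m) ^ c)` for some constant `c`. -/
def IsNearlyLinear (T : ℕ → ℕ) : Prop :=
  ∃ c : ℕ, (fun m => (T m : ℝ)) =O[Filter.atTop] fun m : ℕ => (m : ℝ) * Real.log m ^ c

/-!
The program rounds in the bits of the edge values, from the lowest bit on. It splits `x e` into the
integral part and a fractional part, which it multiplies by a power of two `M > m` and rounds down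
to a word `a e`. This loses less than `1` in total (`floor_sum_le`). Each of the `log₂ M` rounds
then replaces `a` by `a / 2`, where the odd values are rounded up or down such that the sum at each
vertex does not exceed its demand and the total sum, relative to the scale, does not decrease. After
the last round, the integral parts and `a` form an integral `b`-matching of size at least `⌊k⌋`, and
a final pass cuts it down to size exactly `⌊k⌋` (`Merging.sum_eq`).

In a round, the edges with an odd value are decomposed into closed trails and paths, by pairing the
half-edges at each vertex as far as possible, and the edges of each trail and path are rounded up
and down alternately. Closed trails have even length, because the graph is bipartite, so at every
vertex the changes cancel out, but for at most one end of a path (`Paths.Valid.sum_vertex_le`). An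
end changes the sum at its vertex by half a unit, which the demand, an integer, leaves room for if
the sum is odd (`two_mul_degree_halve_le`). One of the two signings of each path does not decrease
the total sum: any that rounds up at an end of the path (`Paths.Valid.sum_nonneg`).

The paths are never traversed. The edges are inserted one by one, and a path is stored at its two
ends only: each knows the other one, a root edge of the path, and the parity of the sign changes
between itself and the root. When two paths are joined, the root of the older one becomes a child
of the edge that is being inserted, with the relative sign of the two (`Paths.join`). Parents have
larger numbers than their children, so a pass over the edges in decreasing order computes all signs
from those of the remaining roots. Hence every part of a round is a loop with a constant number of
steps per edge. `Paths.Valid` is the invariant of the insertion; it states the effect of the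
relations on all signs that obey them, without reference to the trails and paths themselves.

The program is written in a small language of structured commands, for which `Spec` states total
correctness with a bound on the number of steps, and `wp` computes the weakest preconditions of the
loop bodies.
-/

/-! ### Structured programs for the machine -/

namespace RealRAM

/-- The data of a configuration, without the current line. -/
structure Store where
  reg : ℕ → ℕ
  rreg : ℕ → ℝ
  mem : ℕ → ℕ → ℕ
  rmem : ℕ → ℕ → ℝ

namespace Store

/-- The configuration with the data `s` at line `l`. -/
def atLine (s : Store) (l : ℕ) : State := ⟨l, s.reg, s.rreg, s.mem, s.rmem⟩

def setReg (s : Store) (d k : ℕ) : Store := { s with reg := Function.update s.reg d k }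

def setRReg (s : Store) (d : ℕ) (z : ℝ) : Store := { s with rreg := Function.update s.rreg d z }

def setMem (s : Store) (A i k : ℕ) : Store := { s with mem := State.setEntry s.mem A i k }

def setRMem (s : Store) (A i : ℕ) (z : ℝ) : Store := { s with rmem := State.setEntry s.rmem A i z }

end Store

/-- A test: the comparison of two word registers or of two real registers. -/
inductive Test where
  | word (a c : ℕ)
  | real (a c : ℕ)

namespace Test

/-- The jump to line `l` on success of the test. -/
def jump : Test → ℕ → Instr
  | word a c, l => .jlt a c l
  | real a c, l => .rjlt a c l

def Holds : Test → Store → Prop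
  | word a c, s => s.reg a < s.reg c
  | real a c, s => s.rreg a < s.rreg c

theorem exec_jump_of_holds {b : Test} {s : Store} (h : b.Holds s) (w k l : ℕ) :
    exec w (s.atLine k) (b.jump l) = some (s.atLine l) := by
  cases b <;> simp only [Holds] at h <;> simp [exec, jump, Store.atLine, h]

theorem exec_jump_of_not_holds {b : Test} {s : Store} (h : ¬ b.Holds s) (w k l : ℕ) :
    exec w (s.atLine k) (b.jump l) = some (s.atLine (k + 1)) := by
  cases b <;> simp only [Holds] at h <;> simp [exec, jump, Store.atLine, h]

end Test

/-- Structured commands: straight-line blocks (of instructions without jumps), sequences,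
conditionals, and loops that run as long as a test succeeds. -/
inductive Cmd where
  | ops (l : List Instr)
  | seq (p q : Cmd)
  | ite (b : Test) (p q : Cmd)
  | loop (b : Test) (p : Cmd)

namespace Cmd

/-- The number of lines of the compiled command. -/
def len : Cmd → ℕ
  | ops l => l.length
  | seq p q => p.len + q.len
  | ite _ p q => q.len + p.len + 2
  | .loop _ p => p.len + 3

/-- The program text of a command that is placed at line `o`. -/
def compile : Cmd → ℕ → Program
  | ops l, _ => l
  | seq p q, o => p.compile o ++ q.compile (o + p.len)
  | ite b p q, o => b.jump (o + q.len + 2) ::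
      (q.compile (o + 1) ++ .jump (o + q.len + 2 + p.len) :: p.compile (o + q.len + 2))
  | .loop b p, o => b.jump (o + 2) :: .jump (o + p.len + 3) :: (p.compile (o + 2) ++ [.jump o])

theorem length_compile (p : Cmd) (o : ℕ) : (p.compile o).length = p.len := by
  induction p generalizing o with
  | ops l => rfl
  | seq p q hp hq => simp [compile, len, hp, hq]
  | ite b p q hp hq => simp [compile, len, hp, hq]; omega
  | loop b p hp => simp [compile, len, hp]

/-- The largest number of steps that a command without loops can take. -/
def cost : Cmd → ℕ
  | ops l => l.length
  | seq p q => p.cost + q.cost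
  | ite _ p q => max p.cost q.cost + 2
  | .loop _ _ => 0

end Cmd

/-- The weakest precondition of a straight-line block: the block does not fail from `s`, and then
`Q` holds. -/
def wpOps (w : ℕ) : List Instr → (Store → Prop) → Store → Prop
  | [], Q, s => Q s
  | .const d k :: l, Q, s => k < 2 ^ w ∧ wpOps w l Q (s.setReg d k)
  | .add d a c :: l, Q, s =>
      s.reg a + s.reg c < 2 ^ w ∧ wpOps w l Q (s.setReg d (s.reg a + s.reg c))
  | .sub d a c :: l, Q, s =>
      s.reg a - s.reg c < 2 ^ w ∧ wpOps w l Q (s.setReg d (s.reg a - s.reg c))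
  | .mul d a c :: l, Q, s =>
      s.reg a * s.reg c < 2 ^ w ∧ wpOps w l Q (s.setReg d (s.reg a * s.reg c))
  | .div d a c :: l, Q, s =>
      s.reg a / s.reg c < 2 ^ w ∧ wpOps w l Q (s.setReg d (s.reg a / s.reg c))
  | .load d A a :: l, Q, s =>
      s.mem A (s.reg a) < 2 ^ w ∧ wpOps w l Q (s.setReg d (s.mem A (s.reg a)))
  | .store A a c :: l, Q, s => wpOps w l Q (s.setMem A (s.reg a) (s.reg c))
  | .radd d a c :: l, Q, s => wpOps w l Q (s.setRReg d (s.rreg a + s.rreg c))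
  | .rsub d a c :: l, Q, s => wpOps w l Q (s.setRReg d (s.rreg a - s.rreg c))
  | .cast d a :: l, Q, s => wpOps w l Q (s.setRReg d (s.reg a : ℝ))
  | .floor d a :: l, Q, s => ⌊s.rreg a⌋₊ < 2 ^ w ∧ wpOps w l Q (s.setReg d ⌊s.rreg a⌋₊)
  | .rload d A a :: l, Q, s => wpOps w l Q (s.setRReg d (s.rmem A (s.reg a)))
  | .rstore A a c :: l, Q, s => wpOps w l Q (s.setRMem A (s.reg a) (s.rreg c))
  | .jump _ :: _, _, _ => False
  | .jlt _ _ _ :: _, _, _ => False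
  | .rjlt _ _ _ :: _, _, _ => False
  | .halt :: _, _, _ => False

/-- The weakest precondition of a command without loops. -/
def wp (w : ℕ) : Cmd → (Store → Prop) → Store → Prop
  | .ops l, Q, s => wpOps w l Q s
  | .seq p q, Q, s => wp w p (wp w q Q) s
  | .ite b p q, Q, s => (b.Holds s → wp w p Q s) ∧ (¬ b.Holds s → wp w q Q s)
  | .loop _ _, _, _ => False

/-- Total correctness with a time bound: wherever `p` is placed in a program, it leads from the
data `s` at its first line within `T` steps to the line behind it, with data that satisfy `Q`. -/
def Spec (w : ℕ) (p : Cmd) (T : ℕ) (s : Store) (Q : Store → Prop) : Prop :=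
  ∃ t ≤ T, ∃ s', Q s' ∧ ∀ pre post : Program,
    run w (pre ++ p.compile pre.length ++ post) t (s.atLine pre.length)
      = some (s'.atLine (pre.length + p.len))

theorem run_add (w : ℕ) (prog : Program) (t u : ℕ) (s : State) :
    run w prog (t + u) s = run w prog t s >>= run w prog u := by
  induction t generalizing s with
  | zero => simp [run]
  | succ t ih =>
    rw [Nat.succ_add]
    simp only [run]
    cases step w prog s with
    | none => rfl
    | some s' => exact ih s'

theorem run_succ_of_getElem {w : ℕ} {prog : Program} {t : ℕ} {s s' : State} {i : Instr}
    (hi : prog[s.pc]? = some i) (he : exec w s i = some s') :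
    run w prog (t + 1) s = run w prog t s' := by
  simp [run, step, hi, he]

variable {w : ℕ} {p q : Cmd} {T T' : ℕ} {s : Store} {Q R : Store → Prop}

theorem Spec.mono (h : Spec w p T s Q) (hT : T ≤ T') (hQ : ∀ s, Q s → R s) : Spec w p T' s R := by
  obtain ⟨t, ht, s', hs, h⟩ := h
  exact ⟨t, ht.trans hT, s', hQ _ hs, h⟩

theorem Spec.seq (h : Spec w p T s fun s' => Spec w q T' s' Q) :
    Spec w (.seq p q) (T + T') s Q := by
  obtain ⟨t, ht, s₁, ⟨u, hu, s₂, hQ, h₂⟩, h₁⟩ := h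
  refine ⟨t + u, by omega, s₂, hQ, fun pre post => ?_⟩
  have e₁ := h₁ pre (q.compile (pre.length + p.len) ++ post)
  have e₂ := h₂ (pre ++ p.compile pre.length) post
  simp only [List.length_append, Cmd.length_compile, List.append_assoc] at e₁ e₂
  simp only [Cmd.compile, Cmd.len, List.append_assoc]
  rw [run_add, e₁, Option.bind_eq_bind, Option.bind_some, e₂]
  simp [add_assoc]

theorem spec_ops {l : List Instr} (h : wpOps w l Q s) : Spec w (.ops l) l.length s Q := by
  have key : ∃ s', Q s' ∧ ∀ pre post : Program,
      run w (pre ++ l ++ post) l.length (s.atLine pre.length)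
        = some (s'.atLine (pre.length + l.length)) := by
    induction l generalizing s with
    | nil => exact ⟨s, h, fun pre post => by simp [run]⟩
    | cons i l ih =>
      obtain ⟨s₁, h₁, he⟩ : ∃ s₁, wpOps w l Q s₁ ∧
          ∀ k, exec w (s.atLine k) i = some (s₁.atLine (k + 1)) := by
        cases i <;> simp only [wpOps] at h <;>
          first
          | exact h.elim
          | exact ⟨_, h.2, fun k => if_pos h.1⟩
          | exact ⟨_, h, fun k => rfl⟩
      obtain ⟨s', hs', hr⟩ := ih h₁
      refine ⟨s', hs', fun pre post => ?_⟩
      have := hr (pre ++ [i]) post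
      rw [List.length_cons,
        run_succ_of_getElem (i := i) (s' := s₁.atLine (pre.length + 1)) _ (he _)]
      · simpa [add_assoc, add_comm 1] using this
      · simp [Store.atLine]
  obtain ⟨s', hs', hr⟩ := key
  exact ⟨_, le_rfl, s', hs', hr⟩

theorem Spec.ite {b : Test} (hp : b.Holds s → Spec w p T s Q)
    (hq : ¬ b.Holds s → Spec w q T s Q) : Spec w (.ite b p q) (T + 2) s Q := by
  by_cases hc : b.Holds s
  · obtain ⟨t, ht, s', hs', h⟩ := hp hc
    refine ⟨t + 1, by omega, s', hs', fun pre post => ?_⟩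
    rw [run_succ_of_getElem (i := b.jump (pre.length + q.len + 2))
      (s' := s.atLine (pre.length + q.len + 2)) _ (Test.exec_jump_of_holds hc ..)]
    · have := h (pre ++ b.jump (pre.length + q.len + 2) :: (q.compile (pre.length + 1) ++
        [.jump (pre.length + q.len + 2 + p.len)])) post
      have e : (pre ++ b.jump (pre.length + q.len + 2) :: (q.compile (pre.length + 1) ++
        [.jump (pre.length + q.len + 2 + p.len)])).length = pre.length + q.len + 2 := by
        simp [Cmd.length_compile]; omega
      rw [e] at this
      have e' : pre.length + (q.len + p.len + 2) = pre.length + q.len + 2 + p.len := by omega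
      simpa [Cmd.compile, Cmd.len, e'] using this
    · simp [Cmd.compile, Store.atLine]
  · obtain ⟨t, ht, s', hs', h⟩ := hq hc
    refine ⟨(t + 1) + 1, by omega, s', hs', fun pre post => ?_⟩
    rw [run_succ_of_getElem (i := b.jump (pre.length + q.len + 2))
      (s' := s.atLine (pre.length + 1)) _ (Test.exec_jump_of_not_holds hc ..), run_add]
    · have := h (pre ++ [b.jump (pre.length + q.len + 2)])
        (.jump (pre.length + q.len + 2 + p.len) :: p.compile (pre.length + q.len + 2) ++ post)
      simp only [List.length_append, List.length_cons, List.length_nil, List.append_assoc,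
        List.cons_append, List.nil_append, zero_add] at this
      simp only [Cmd.compile, List.append_assoc, List.cons_append]
      rw [this, Option.bind_eq_bind, Option.bind_some, run_succ_of_getElem
        (i := .jump (pre.length + q.len + 2 + p.len))
        (s' := s'.atLine (pre.length + q.len + 2 + p.len)) _ rfl]
      · simp [run, Cmd.len, add_left_comm, add_comm]
      · have e : pre.length + 1 + q.len = (pre ++ b.jump (pre.length + q.len + 2) ::
          q.compile (pre.length + 1)).length := by
          simp [Cmd.length_compile]; omega
        have e2 : (s'.atLine (pre.length + 1 + q.len)).pc = pre.length + 1 + q.len := rfl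
        rw [e2, e, ← List.cons_append, ← List.append_assoc]
        simp
    · simp [Cmd.compile, Store.atLine]

theorem Spec.loop_exit {b : Test} (hb : ¬ b.Holds s) (hQ : Q s) : Spec w (.loop b p) 2 s Q := by
  refine ⟨2, le_rfl, s, hQ, fun pre post => ?_⟩
  rw [run_succ_of_getElem (i := b.jump (pre.length + 2))
      (s' := s.atLine (pre.length + 1)) _ (Test.exec_jump_of_not_holds hb ..),
    run_succ_of_getElem (i := .jump (pre.length + p.len + 3))
      (s' := s.atLine (pre.length + p.len + 3)) _ rfl]
  · simp [run, Cmd.len, add_assoc]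
  · simp [Cmd.compile, Store.atLine]
  · simp [Cmd.compile, Store.atLine]

theorem Spec.loop_step {b : Test} (hb : b.Holds s)
    (h : Spec w p T s fun s' => Spec w (.loop b p) T' s' Q) :
    Spec w (.loop b p) (T + T' + 2) s Q := by
  obtain ⟨t, ht, s₁, ⟨u, hu, s₂, hQ, h₂⟩, h₁⟩ := h
  refine ⟨(t + (u + 1)) + 1, by omega, s₂, hQ, fun pre post => ?_⟩
  rw [run_succ_of_getElem (i := b.jump (pre.length + 2))
      (s' := s.atLine (pre.length + 2)) _ (Test.exec_jump_of_holds hb ..), run_add]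
  · have e₁ := h₁ (pre ++ [b.jump (pre.length + 2), .jump (pre.length + p.len + 3)])
      ([.jump pre.length] ++ post)
    have e₂ := h₂ pre post
    simp only [List.length_append, List.length_cons, List.length_nil, List.append_assoc,
        List.cons_append, List.nil_append, zero_add, Nat.reduceAdd] at e₁
    rw [show pre ++ (Cmd.loop b p).compile pre.length ++ post = pre ++ (b.jump (pre.length + 2) ::
      .jump (pre.length + p.len + 3) :: (p.compile (pre.length + 2) ++ .jump pre.length :: post)) by
        simp [Cmd.compile]] at e₂ ⊢
    rw [e₁, Option.bind_eq_bind, Option.bind_some, run_succ_of_getElem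
      (i := .jump pre.length) (s' := s₁.atLine pre.length) _ rfl, e₂]
    have e : pre.length + 2 + p.len = (pre ++ (b.jump (pre.length + 2) ::
      .jump (pre.length + p.len + 3) :: p.compile (pre.length + 2))).length := by
      simp [Cmd.length_compile]; omega
    have e2 : (s₁.atLine (pre.length + 2 + p.len)).pc = pre.length + 2 + p.len := rfl
    rw [e2, e, ← List.cons_append, ← List.cons_append, ← List.append_assoc]
    simp
  · simp [Cmd.compile, Store.atLine]

/-- A loop that makes `N` passes, with the invariant `I j` after `j` passes. -/
theorem Spec.loop {b : Test} {N : ℕ} (I : ℕ → Store → Prop) (h₀ : I 0 s)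
    (hb : ∀ j s, I j s → (b.Holds s ↔ j < N))
    (hp : ∀ j s, j < N → I j s → Spec w p T s (I (j + 1))) :
    Spec w (.loop b p) (N * (T + 2) + 2) s (I N) := by
  have key : ∀ k j s, j + k = N → I j s → Spec w (.loop b p) (k * (T + 2) + 2) s (I N) := by
    intro k
    induction k with
    | zero =>
      intro j s hj hI
      have hj : j = N := by omega
      subst hj
      exact (Spec.loop_exit (by simp [hb j s hI]) hI).mono (by omega) fun _ h => h
    | succ k ih =>
      intro j s hj hI
      refine ((Spec.loop_step ((hb j s hI).2 (by omega))
        ((hp j s (by omega) hI).mono le_rfl fun s' h => ih (j + 1) s' (by omega) h))).mono ?_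
          fun _ h => h
      rw [Nat.succ_mul]; omega
  exact key N 0 s (by omega) h₀

theorem wpOps_mono {l : List Instr} (h : wpOps w l Q s) (hQ : ∀ s, Q s → R s) : wpOps w l R s := by
  induction l generalizing s with
  | nil => exact hQ _ h
  | cons i l ih =>
    cases i <;> simp only [wpOps] at h ⊢ <;>
      first
      | exact ⟨h.1, ih h.2⟩
      | exact ih h

theorem wp_mono (h : wp w p Q s) (hQ : ∀ s, Q s → R s) : wp w p R s := by
  induction p generalizing s Q R with
  | ops l => exact wpOps_mono h hQ
  | seq p q hp hq => exact hp h fun s' h' => hq h' hQ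
  | ite b p q hp hq => exact ⟨fun hb => hp (h.1 hb) hQ, fun hb => hq (h.2 hb) hQ⟩
  | loop b p hp => exact h

/-- The weakest precondition is sound, within the number of steps `Cmd.cost`. -/
theorem spec_of_wp (h : wp w p Q s) : Spec w p p.cost s Q := by
  induction p generalizing s Q with
  | ops l => exact spec_ops h
  | seq p q hp hq => exact (Spec.mono (hp h) le_rfl fun s' h' => hq h').seq
  | ite b p q hp hq =>
    exact Spec.ite (fun hb => (hp (h.1 hb)).mono (le_max_left ..) fun _ h => h)
      (fun hb => (hq (h.2 hb)).mono (le_max_right ..) fun _ h => h)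
  | loop b p hp => exact h.elim

end RealRAM

/-! ### Families of alternating paths -/

namespace RealRAM

/-- The arrays that describe a family of paths. Edge `p ≥ 1` has the two half-edges `2 * p` and
`2 * p + 1`. A path is represented by one of its edges, the root. For a half-edge `h` at the end of
a path, `other h` is the half-edge at the other end, `root h` the root of the path, and `rel h` the
parity of the number of sign changes between the edge of `h` and the root. An edge `p` that was the
root of a path before this path became a part of a longer one has the root `par p ≠ 0` of that
longer path as its parent, and `flip p` says whether the two have different signs. -/
structure Paths where
  other : ℕ → ℕ
  root : ℕ → ℕ
  rel : ℕ → ℕ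
  par : ℕ → ℕ
  flip : ℕ → ℕ

namespace Paths

/-- The edge signs `s` obey the recorded relations between the edges and their parents. -/
def Compatible (D : Paths) (s : ℕ → ℤ) : Prop :=
  ∀ p, D.par p ≠ 0 → s p = (-1) ^ D.flip p * s (D.par p)

/-- The arrays `D` describe a partition of the edges in `O`, whose numbers are at most `q`, into
closed trails and paths, such that `E` is the set of the half-edges at the ends of the paths.
Half-edge `h` is at the vertex `vert h`, and `τ` is `1` on one side of the bipartite graph and `-1`
on the other one. For signs that alternate along the trails and paths, only the ends contribute to
a sum over all half-edges. -/
structure Valid (D : Paths) (vert : ℕ → ℕ) (τ : ℕ → ℤ) (q : ℕ) (O E : Finset ℕ) : Prop where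
  other_mem : ∀ h ∈ E, D.other h ∈ E
  other_other : ∀ h ∈ E, D.other (D.other h) = h
  other_ne : ∀ h ∈ E, D.other h ≠ h
  root_other : ∀ h ∈ E, D.root (D.other h) = D.root h
  root_inj : ∀ h ∈ E, ∀ k ∈ E, D.root k = D.root h → k = h ∨ k = D.other h
  par_root : ∀ h ∈ E, D.par (D.root h) = 0
  root_pos : ∀ h ∈ E, 1 ≤ D.root h
  root_le : ∀ h ∈ E, D.root h ≤ q
  le_of_mem : ∀ h ∈ E, h ≤ 2 * q + 1
  two_le_of_mem : ∀ h ∈ E, 2 ≤ h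
  rel_le : ∀ h ∈ E, D.rel h ≤ 1
  flip_le : ∀ p, D.par p ≠ 0 → D.flip p ≤ 1
  lt_par : ∀ p, D.par p ≠ 0 → p < D.par p
  par_le : ∀ p, D.par p ≤ q
  par_zero : D.par 0 = 0
  side : ∀ h ∈ E, (-1) ^ D.rel h * (-1) ^ D.rel (D.other h) = - (τ (vert h) * τ (vert (D.other h)))
  sign : ∀ s, D.Compatible s → ∀ h ∈ E, s (h / 2) = (-1) ^ D.rel h * s (D.root h)
  sum : ∀ s, D.Compatible s → ∀ f : ℕ → ℤ,
    ∑ p ∈ O, (f (vert (2 * p)) + f (vert (2 * p + 1))) * s p = ∑ h ∈ E, f (vert h) * s (h / 2)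

variable {D : Paths} {vert : ℕ → ℕ} {τ : ℕ → ℤ} {q : ℕ} {O E : Finset ℕ}

theorem neg_one_pow_natDist (x y : ℕ) : (-1 : ℤ) ^ (x - y + (y - x)) = (-1) ^ x * (-1) ^ y := by
  rw [← pow_add]
  apply neg_one_pow_congr
  grind

theorem valid_empty (hp : ∀ p, D.par p = 0) : D.Valid vert τ 0 ∅ ∅ := by
  constructor <;> simp [hp]

/-- The new edge `i` as a path of its own. -/
def addEdge (D : Paths) (i : ℕ) : Paths :=
  { D with
    other := Function.update (Function.update D.other (2 * i) (2 * i + 1)) (2 * i + 1) (2 * i)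
    root := Function.update (Function.update D.root (2 * i) i) (2 * i + 1) i
    rel := Function.update (Function.update D.rel (2 * i) 0) (2 * i + 1) 0 }

theorem Valid.mono {q' : ℕ} (hD : D.Valid vert τ q O E) (hq : q ≤ q') : D.Valid vert τ q' O E :=
  { hD with
    root_le := fun h hh => (hD.root_le h hh).trans hq
    le_of_mem := fun h hh => (hD.le_of_mem h hh).trans (by omega)
    par_le := fun p => (hD.par_le p).trans hq }

theorem Valid.addEdge (hD : D.Valid vert τ q O E) (hO : q + 1 ∉ O)
    (hτ : τ (vert (2 * (q + 1))) * τ (vert (2 * (q + 1) + 1)) = -1) :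
    (D.addEdge (q + 1)).Valid vert τ (q + 1) (insert (q + 1) O)
      (insert (2 * (q + 1)) (insert (2 * (q + 1) + 1) E)) := by
  have hle := hD.le_of_mem
  have ne₁ : 2 * (q + 1) ∉ E := fun h => by have := hle _ h; omega
  have ne₂ : 2 * (q + 1) + 1 ∉ E := fun h => by have := hle _ h; omega
  have hm : ∀ h ∈ E, h ≠ 2 * (q + 1) ∧ h ≠ 2 * (q + 1) + 1 ∧ D.other h ≠ 2 * (q + 1) ∧
      D.other h ≠ 2 * (q + 1) + 1 := fun h hh => by
    have h1 := hle _ hh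
    have h2 := hle _ (hD.other_mem h hh)
    omega
  have hpar : D.par (q + 1) = 0 := by
    by_contra h
    have h1 := hD.lt_par _ h
    have h2 := hD.par_le (q + 1)
    omega
  have h12 : 2 * (q + 1) + 1 ≠ 2 * (q + 1) := by omega
  have h21 : 2 * (q + 1) ≠ 2 * (q + 1) + 1 := by omega
  constructor
  case other_mem =>
    intro h hh
    simp only [Finset.mem_insert] at hh
    rcases hh with rfl | rfl | hh
    · simp [Paths.addEdge]
    · simp [Paths.addEdge]
    · simp [Paths.addEdge, hm h hh, hD.other_mem h hh]
  case other_other =>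
    intro h hh
    simp only [Finset.mem_insert] at hh
    rcases hh with rfl | rfl | hh
    · simp [Paths.addEdge]
    · simp [Paths.addEdge]
    · simp [Paths.addEdge, hm h hh, hD.other_other h hh]
  case other_ne =>
    intro h hh
    simp only [Finset.mem_insert] at hh
    rcases hh with rfl | rfl | hh
    · simp [Paths.addEdge]
    · simp [Paths.addEdge]
    · simp [Paths.addEdge, hm h hh, hD.other_ne h hh]
  case root_other =>
    intro h hh
    simp only [Finset.mem_insert] at hh
    rcases hh with rfl | rfl | hh
    · simp [Paths.addEdge]
    · simp [Paths.addEdge]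
    · simp [Paths.addEdge, hm h hh, hD.root_other h hh]
  case root_inj =>
    intro h hh k hk
    have hr := hD.root_le
    have hi := hD.root_inj
    simp only [Finset.mem_insert] at hh hk
    simp only [Paths.addEdge, Function.update_apply]
    grind
  case par_root =>
    intro h hh
    simp only [Finset.mem_insert] at hh
    rcases hh with rfl | rfl | hh
    · simp [Paths.addEdge, hpar]
    · simp [Paths.addEdge, hpar]
    · simp [Paths.addEdge, hm h hh, hD.par_root h hh]
  case root_pos =>
    intro h hh
    simp only [Finset.mem_insert] at hh
    rcases hh with rfl | rfl | hh
    · simp [Paths.addEdge]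
    · simp [Paths.addEdge]
    · simpa [Paths.addEdge, hm h hh] using hD.root_pos h hh
  case root_le =>
    intro h hh
    simp only [Finset.mem_insert] at hh
    rcases hh with rfl | rfl | hh
    · simp [Paths.addEdge]
    · simp [Paths.addEdge]
    · have := hD.root_le h hh
      simp [Paths.addEdge, hm h hh]; omega
  case le_of_mem =>
    intro h hh
    simp only [Finset.mem_insert] at hh
    grind
  case two_le_of_mem =>
    intro h hh
    have := hD.two_le_of_mem
    simp only [Finset.mem_insert] at hh
    grind
  case rel_le =>
    intro h hh
    simp only [Finset.mem_insert] at hh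
    rcases hh with rfl | rfl | hh
    · simp [Paths.addEdge]
    · simp [Paths.addEdge]
    · simpa [Paths.addEdge, hm h hh] using hD.rel_le h hh
  case flip_le => exact hD.flip_le
  case lt_par => exact hD.lt_par
  case par_le => exact fun p => (hD.par_le p).trans (by omega)
  case par_zero => exact hD.par_zero
  case side =>
    intro h hh
    simp only [Finset.mem_insert] at hh
    rcases hh with rfl | rfl | hh
    · simp [Paths.addEdge, hτ]
    · simp [Paths.addEdge, mul_comm (τ (vert (2 * (q + 1) + 1))), hτ]
    · simpa [Paths.addEdge, hm h hh] using hD.side h hh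
  case sign =>
    intro s hs h hh
    simp only [Finset.mem_insert] at hh
    rcases hh with rfl | rfl | hh
    · simp [Paths.addEdge]
    · have : (2 * (q + 1) + 1) / 2 = q + 1 := by omega
      simp [Paths.addEdge, this]
    · simpa [Paths.addEdge, hm h hh] using hD.sign s hs h hh
  case sum =>
    intro s hs f
    have : (2 * (q + 1) + 1) / 2 = q + 1 := by omega
    rw [Finset.sum_insert hO, Finset.sum_insert (by simp [ne₁]), Finset.sum_insert ne₂,
      hD.sum s hs f, this]
    simp; ring

/-- The path with the end `g` becomes a part of the path with the end `h` and the root `i`. -/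
def join (D : Paths) (i g h : ℕ) : Paths where
  other := Function.update (Function.update D.other (D.other g) (D.other h)) (D.other h) (D.other g)
  root := Function.update D.root (D.other g) i
  rel := Function.update D.rel (D.other g)
    (D.rel (D.other g) - (1 - (D.rel g - D.rel h + (D.rel h - D.rel g))) +
      ((1 - (D.rel g - D.rel h + (D.rel h - D.rel g))) - D.rel (D.other g)))
  par := Function.update D.par (D.root g) i
  flip := Function.update D.flip (D.root g) (1 - (D.rel g - D.rel h + (D.rel h - D.rel g)))

theorem sum_erase_pair {g h : ℕ} (hg : g ∈ E) (hh : h ∈ E) (hgh : g ≠ h) (F : ℕ → ℤ)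
    (hF : F g + F h = 0) : ∑ k ∈ (E.erase g).erase h, F k = ∑ k ∈ E, F k := by
  rw [← Finset.add_sum_erase E F hg, ← Finset.add_sum_erase (E.erase g) F
    (Finset.mem_erase.2 ⟨hgh.symm, hh⟩), ← add_assoc, hF, zero_add]

theorem Valid.join (hD : D.Valid vert τ q O E) {g h : ℕ} (hg : g ∈ E) (hh : h ∈ E) (hgh : g ≠ h)
    (hv : vert g = vert h) (hτ : τ (vert h) * τ (vert h) = 1) (hne : D.other g ≠ h)
    (hq : D.root h = q) : (D.join q g h).Valid vert τ q O ((E.erase g).erase h) := by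
  obtain ⟨a, ha⟩ : ∃ a, a = D.other g := ⟨_, rfl⟩
  obtain ⟨b, hb⟩ : ∃ b, b = D.other h := ⟨_, rfl⟩
  have haE := hD.other_mem g hg
  have hbE := hD.other_mem h hh
  have hag := hD.other_other g hg
  have hbh := hD.other_other h hh
  have hag' := hD.other_ne g hg
  have hbh' := hD.other_ne h hh
  have hra := hD.root_other g hg
  have hrb := hD.root_other h hh
  rw [← ha] at haE hag hag' hra hne
  rw [← hb] at hbE hbh hbh' hrb
  have hab : a ≠ b := by grind
  have hbg : b ≠ g := by grind
  have hrne : D.root g ≠ q := fun he => by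
    rcases hD.root_inj h hh g hg (he.trans hq.symm) with h | h
    · exact hgh h
    · exact hbg (hb.trans h.symm)
  have hpq : D.par q = 0 := hq ▸ hD.par_root h hh
  have hpg := hD.par_root g hg
  have hrg := hD.rel_le g hg
  have hrh := hD.rel_le h hh
  have hrga := hD.rel_le a haE
  obtain ⟨z, hz⟩ : ∃ z, z = 1 - (D.rel g - D.rel h + (D.rel h - D.rel g)) := ⟨_, rfl⟩
  have hz1 : z ≤ 1 := by omega
  have hzs : (-1 : ℤ) ^ z = - ((-1) ^ D.rel g * (-1) ^ D.rel h) := by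
    rw [hz]
    generalize D.rel g = x at *
    generalize D.rel h = y at *
    interval_cases x <;> interval_cases y <;> simp
  have hjo : (D.join q g h).other = Function.update (Function.update D.other a b) b a := by
    rw [ha, hb]; rfl
  have hjr : (D.join q g h).root = Function.update D.root a q := by rw [ha]; rfl
  have hjl : (D.join q g h).rel = Function.update D.rel a (D.rel a - z + (z - D.rel a)) := by
    rw [ha, hz]; rfl
  have hjp : (D.join q g h).par = Function.update D.par (D.root g) q := rfl
  have hjf : (D.join q g h).flip = Function.update D.flip (D.root g) z := by rw [hz]; rfl
  have hla : (-1 : ℤ) ^ (D.rel a - z + (z - D.rel a)) = (-1) ^ D.rel a * (-1) ^ z :=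
    neg_one_pow_natDist _ _
  have hla1 : D.rel a - z + (z - D.rel a) ≤ 1 := by omega
  generalize D.rel a - z + (z - D.rel a) = l at *
  have hsg : ∀ x : ℕ, ((-1 : ℤ) ^ x) * (-1) ^ x = 1 := fun x => by
    rw [← mul_pow]; norm_num
  -- Signs that obey the new relations also obey the old ones.
  have hcomp : ∀ s, (D.join q g h).Compatible s → D.Compatible s ∧
      s (D.root g) = (-1) ^ z * s q := by
    intro s hs
    refine ⟨fun p hp => ?_, ?_⟩
    · have hpne : p ≠ D.root g := fun h => hp (h ▸ hpg)
      have := hs p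
      rw [hjp, hjf] at this
      simpa [hpne, hp] using this
    · have := hs (D.root g)
      rw [hjp, hjf] at this
      have hq1 := hD.root_pos h hh
      simpa [show q ≠ 0 by omega] using this
  have cases_mem : ∀ k ∈ (E.erase g).erase h, k ∈ E ∧ k ≠ g ∧ k ≠ h := fun k hk => by
    simp only [Finset.mem_erase] at hk; exact ⟨hk.2.2, hk.2.1, hk.1⟩
  -- Away from `a` and `b`, the ends stay as they are.
  have rest : ∀ k ∈ E, k ≠ g → k ≠ h → k ≠ a → k ≠ b → D.other k ∈ E ∧ D.other k ≠ a ∧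
      D.other k ≠ b ∧ D.other k ≠ g ∧ D.other k ≠ h ∧ D.root k ≠ D.root g ∧ D.root k ≠ q := by
    intro k hk h1 h2 h3 h4
    have hok := hD.other_mem k hk
    have hook := hD.other_other k hk
    have r1 := hD.root_inj g hg k hk
    have r2 := hD.root_inj h hh k hk
    rw [← ha] at r1
    rw [← hb, hq] at r2
    refine ⟨hok, ?_, ?_, ?_, ?_, ?_, ?_⟩ <;> grind
  have ob : (D.join q g h).other b = a := by simp [hjo]
  have oa : (D.join q g h).other a = b := by simp [hjo, hab]
  have ok : ∀ k, k ≠ a → k ≠ b → (D.join q g h).other k = D.other k := fun k h1 h2 => by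
    simp [hjo, h1, h2]
  have ra : (D.join q g h).root a = q := by simp [hjr]
  have rk : ∀ k, k ≠ a → (D.join q g h).root k = D.root k := fun k h1 => by simp [hjr, h1]
  have rb : (D.join q g h).root b = q := by rw [rk b hab.symm, hrb, hq]
  have la : (D.join q g h).rel a = l := by simp [hjl]
  have lk : ∀ k, k ≠ a → (D.join q g h).rel k = D.rel k := fun k h1 => by simp [hjl, h1]
  have split : ∀ k ∈ (E.erase g).erase h, k = a ∨ k = b ∨
      (k ∈ E ∧ k ≠ g ∧ k ≠ h ∧ k ≠ a ∧ k ≠ b) := fun k hk => by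
    have := cases_mem k hk
    tauto
  have mem' : ∀ k ∈ E, k ≠ g → k ≠ h → k ∈ (E.erase g).erase h := fun k h1 h2 h3 => by
    simp [h1, h2, h3]
  have pq : (D.join q g h).par q = 0 := by simp [hjp, hrne.symm, hpq]
  constructor
  case other_mem =>
    intro k hk
    rcases split k hk with rfl | rfl | ⟨h1, h2, h3, h4, h5⟩
    · rw [oa]; exact mem' _ hbE hbg hbh'
    · rw [ob]; exact mem' _ haE hag' hne
    · obtain ⟨r1, r2, r3, r4, r5, r6⟩ := rest k h1 h2 h3 h4 h5
      rw [ok k h4 h5]; exact mem' _ r1 r4 r5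
  case other_other =>
    intro k hk
    rcases split k hk with rfl | rfl | ⟨h1, h2, h3, h4, h5⟩
    · rw [oa, ob]
    · rw [ob, oa]
    · obtain ⟨r1, r2, r3, r4, r5, r6⟩ := rest k h1 h2 h3 h4 h5
      rw [ok k h4 h5, ok _ r2 r3, hD.other_other k h1]
  case other_ne =>
    intro k hk
    rcases split k hk with rfl | rfl | ⟨h1, h2, h3, h4, h5⟩
    · rw [oa]; exact hab.symm
    · rw [ob]; exact hab
    · rw [ok k h4 h5]; exact hD.other_ne k h1
  case root_other =>
    intro k hk
    rcases split k hk with rfl | rfl | ⟨h1, h2, h3, h4, h5⟩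
    · rw [oa, ra, rb]
    · rw [ob, ra, rb]
    · obtain ⟨r1, r2, r3, r4, r5, r6⟩ := rest k h1 h2 h3 h4 h5
      rw [ok k h4 h5, rk _ r2, rk _ h4, hD.root_other k h1]
  case root_inj =>
    intro k hk k' hk' hr
    rcases split k hk with rfl | rfl | ⟨h1, h2, h3, h4, h5⟩ <;>
    rcases split k' hk' with rfl | rfl | ⟨h1', h2', h3', h4', h5'⟩
    · left; rfl
    · right; rw [oa]
    · rw [ra, rk _ h4'] at hr
      exact absurd hr (rest k' h1' h2' h3' h4' h5').2.2.2.2.2.2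
    · right; rw [ob]
    · left; rfl
    · rw [rb, rk _ h4'] at hr
      exact absurd hr (rest k' h1' h2' h3' h4' h5').2.2.2.2.2.2
    · rw [ra, rk _ h4] at hr
      exact absurd hr.symm (rest k h1 h2 h3 h4 h5).2.2.2.2.2.2
    · rw [rb, rk _ h4] at hr
      exact absurd hr.symm (rest k h1 h2 h3 h4 h5).2.2.2.2.2.2
    · rw [rk _ h4, rk _ h4'] at hr
      rw [ok k h4 h5]
      exact hD.root_inj k h1 k' h1' hr
  case par_root =>
    intro k hk
    rcases split k hk with rfl | rfl | ⟨h1, h2, h3, h4, h5⟩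
    · rw [ra, pq]
    · rw [rb, pq]
    · rw [rk _ h4, hjp, Function.update_of_ne (rest k h1 h2 h3 h4 h5).2.2.2.2.2.1]
      exact hD.par_root k h1
  case root_pos =>
    intro k hk
    have := hD.root_pos h hh
    rcases split k hk with rfl | rfl | ⟨h1, h2, h3, h4, h5⟩
    · rw [ra]; omega
    · rw [rb]; omega
    · rw [rk _ h4]; exact hD.root_pos k h1
  case root_le =>
    intro k hk
    rcases split k hk with rfl | rfl | ⟨h1, h2, h3, h4, h5⟩
    · rw [ra]
    · rw [rb]
    · rw [rk _ h4]; exact hD.root_le k h1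
  case le_of_mem => exact fun k hk => hD.le_of_mem k (cases_mem k hk).1
  case two_le_of_mem => exact fun k hk => hD.two_le_of_mem k (cases_mem k hk).1
  case rel_le =>
    intro k hk
    rcases eq_or_ne k a with rfl | h4
    · rw [la]; exact hla1
    · rw [lk _ h4]; exact hD.rel_le k (cases_mem k hk).1
  case flip_le =>
    intro p hp
    rcases eq_or_ne p (D.root g) with rfl | h1
    · rw [hjf, Function.update_self]; exact hz1
    · rw [hjp, Function.update_of_ne h1] at hp
      rw [hjf, Function.update_of_ne h1]
      exact hD.flip_le p hp
  case lt_par =>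
    intro p hp
    rcases eq_or_ne p (D.root g) with rfl | h1
    · rw [hjp, Function.update_self]; exact lt_of_le_of_ne (hD.root_le g hg) hrne
    · rw [hjp, Function.update_of_ne h1] at hp ⊢
      exact hD.lt_par p hp
  case par_le =>
    intro p
    rcases eq_or_ne p (D.root g) with rfl | h1
    · rw [hjp, Function.update_self]
    · rw [hjp, Function.update_of_ne h1]
      exact hD.par_le p
  case par_zero =>
    have := hD.root_pos g hg
    rw [hjp, Function.update_of_ne (by omega)]
    exact hD.par_zero
  case side =>
    have s1 := hD.side g hg
    have s2 := hD.side h hh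
    rw [← ha, hv] at s1
    rw [← hb] at s2
    have e1 := hsg (D.rel g)
    have e2 := hsg (D.rel h)
    have key : (-1 : ℤ) ^ l * (-1) ^ D.rel b = -(τ (vert a) * τ (vert b)) := by
      rw [hla, hzs]
      linear_combination (-(-1 : ℤ) ^ D.rel h * (-1) ^ D.rel b) * s1 +
        (τ (vert h) * τ (vert a)) * s2 - (τ (vert a) * τ (vert b)) * hτ
    intro k hk
    rcases split k hk with rfl | rfl | ⟨h1, h2, h3, h4, h5⟩
    · rw [oa, la, lk _ hab.symm]; exact key
    · rw [ob, la, lk _ hab.symm]; linear_combination key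
    · obtain ⟨r1, r2, r3, r4, r5, r6⟩ := rest k h1 h2 h3 h4 h5
      rw [ok k h4 h5, lk _ h4, lk _ r2]; exact hD.side k h1
  case sign =>
    intro s hs k hk
    obtain ⟨hs1, hs2⟩ := hcomp s hs
    rcases eq_or_ne k a with rfl | h4
    · rw [la, ra, hla, hD.sign s hs1 _ haE, hra, hs2]; ring
    · rw [lk _ h4, rk _ h4]
      exact hD.sign s hs1 _ (cases_mem k hk).1
  case sum =>
    intro s hs f
    obtain ⟨hs1, hs2⟩ := hcomp s hs
    rw [hD.sum s hs1 f, sum_erase_pair hg hh hgh]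
    have e1 := hsg (D.rel g)
    rw [hD.sign s hs1 g hg, hD.sign s hs1 h hh, hs2, hzs, hv, hq]
    linear_combination (-f (vert h) * (-1) ^ D.rel h * s q) * e1

/-- The two ends of a path meet, and the path becomes a closed trail. Its length is even, because
the graph is bipartite. -/
theorem Valid.close (hD : D.Valid vert τ q O E) {g h : ℕ} (hg : g ∈ E) (hh : h ∈ E) (hgh : g ≠ h)
    (hv : vert g = vert h) (hτ : τ (vert h) * τ (vert h) = 1) (he : D.other g = h) :
    D.Valid vert τ q O ((E.erase g).erase h) := by
  have hhg : D.other h = g := he ▸ hD.other_other g hg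
  have cases_mem : ∀ k ∈ (E.erase g).erase h, k ∈ E ∧ k ≠ g ∧ k ≠ h := fun k hk => by
    simp only [Finset.mem_erase] at hk; exact ⟨hk.2.2, hk.2.1, hk.1⟩
  refine { hD with
    other_mem := fun k hk => ?_
    other_other := fun k hk => hD.other_other k (cases_mem k hk).1
    other_ne := fun k hk => hD.other_ne k (cases_mem k hk).1
    root_other := fun k hk => hD.root_other k (cases_mem k hk).1
    root_inj := fun k hk k' hk' => hD.root_inj k (cases_mem k hk).1 k' (cases_mem k' hk').1
    par_root := fun k hk => hD.par_root k (cases_mem k hk).1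
    root_pos := fun k hk => hD.root_pos k (cases_mem k hk).1
    root_le := fun k hk => hD.root_le k (cases_mem k hk).1
    le_of_mem := fun k hk => hD.le_of_mem k (cases_mem k hk).1
    two_le_of_mem := fun k hk => hD.two_le_of_mem k (cases_mem k hk).1
    rel_le := fun k hk => hD.rel_le k (cases_mem k hk).1
    side := fun k hk => hD.side k (cases_mem k hk).1
    sign := fun s hs k hk => hD.sign s hs k (cases_mem k hk).1
    sum := fun s hs f => ?_ }
  · obtain ⟨h1, h2, h3⟩ := cases_mem k hk
    have h4 := hD.other_other k h1
    simp only [Finset.mem_erase]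
    exact ⟨fun h => h2 (by rw [← h4, h, hhg]), fun h => h3 (by rw [← h4, h, he]),
      hD.other_mem k h1⟩
  · rw [hD.sum s hs f, sum_erase_pair hg hh hgh]
    have s1 := hD.side g hg
    rw [he, hv, hτ] at s1
    have e1 : ((-1 : ℤ) ^ D.rel g) * (-1) ^ D.rel g = 1 := by rw [← mul_pow]; norm_num
    have hr : D.root g = D.root h := by rw [← hD.root_other g hg, he]
    rw [hD.sign s hs g hg, hD.sign s hs h hh, hv, hr]
    linear_combination (f (vert h) * s (D.root h) * (-1) ^ D.rel g) * s1 -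
      (f (vert h) * s (D.root h) * (-1) ^ D.rel h) * e1

end Paths
end RealRAM

/-! ### Half-edges at the vertices, and the effect of a round on the sums -/

namespace RealRAM
namespace Paths

/-- `slot v` is the half-edge of `E` at the vertex `v` that is not in `L`, if there is one, and `0`
otherwise; there is at most one. The half-edges in `L` have not been attached to their vertices. -/
structure Slots (vert slot : ℕ → ℕ) (E L : Finset ℕ) : Prop where
  subset : L ⊆ E
  mem : ∀ v, slot v ≠ 0 → slot v ∈ E ∧ slot v ∉ L ∧ vert (slot v) = v
  slot_vert : ∀ h ∈ E, h ∉ L → slot (vert h) = h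

variable {D : Paths} {vert slot : ℕ → ℕ} {τ : ℕ → ℤ} {q : ℕ} {O E L : Finset ℕ}

/-- The paths after the loose end `h` of the path with the root `i` has been attached to its
vertex, where the half-edge `g` was waiting (none if `g = 0`). -/
def attach (D : Paths) (i g h : ℕ) : Paths :=
  if g = 0 ∨ D.other g = h then D else D.join i g h

/-- The new waiting half-edge at a vertex to which `h` has been attached. -/
def newSlot (g h : ℕ) : ℕ := if g = 0 then h else 0

theorem Valid.attach (hD : D.Valid vert τ q O E) (hS : Slots vert slot E L) {h : ℕ} (hh : h ∈ L)
    (hτ : ∀ v, τ v * τ v = 1) (hq : D.root h = q) :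
    ∃ E', (D.attach q (slot (vert h)) h).Valid vert τ q O E' ∧
      Slots vert (Function.update slot (vert h) (newSlot (slot (vert h)) h)) E' (L.erase h) ∧
      ∀ k, D.root k = q → (D.attach q (slot (vert h)) h).root k = q := by
  have hE := hS.subset hh
  have h2 := hD.two_le_of_mem h hE
  by_cases hg : slot (vert h) = 0
  · refine ⟨E, ?_, ⟨fun k hk => hS.subset (Finset.mem_of_mem_erase hk), fun v hv => ?_,
      fun k hk hkL => ?_⟩, ?_⟩
    · simpa [Paths.attach, hg] using hD
    · by_cases hvh : v = vert h
      · subst hvh; simpa [newSlot, hg] using hE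
      · simp only [newSlot, hg, if_true, Function.update_of_ne hvh] at hv ⊢
        have := hS.mem v hv
        simp [this]
    · by_cases hkh : k = h
      · subst hkh; simp [newSlot, hg]
      · have hkL' : k ∉ L := fun hL => hkL (Finset.mem_erase.2 ⟨hkh, hL⟩)
        have := hS.slot_vert k hk hkL'
        have hne : vert k ≠ vert h := fun hv => by
          have hk2 := hD.two_le_of_mem k hk
          rw [hv, hg] at this
          omega
        simp [Function.update_of_ne hne, this]
    · simp [Paths.attach, hg]
  · obtain ⟨g, hgs⟩ : ∃ g, slot (vert h) = g := ⟨_, rfl⟩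
    obtain ⟨hgE, hgL, hgv⟩ := hS.mem _ hg
    rw [hgs] at hg hgE hgL hgv ⊢
    have hgh : g ≠ h := fun h' => hgL (h' ▸ hh)
    have hslots : Slots vert (Function.update slot (vert h) (newSlot g h))
        ((E.erase g).erase h) (L.erase h) := by
      refine ⟨fun k hk => ?_, fun v hv => ?_, fun k hk hkL => ?_⟩
      · have hkL := Finset.mem_of_mem_erase hk
        simp only [Finset.mem_erase]
        exact ⟨Finset.ne_of_mem_erase hk, fun h' => hgL (h' ▸ hkL), hS.subset hkL⟩
      · by_cases hvh : v = vert h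
        · subst hvh; simp [newSlot, hg] at hv
        · rw [Function.update_of_ne hvh] at hv ⊢
          obtain ⟨m1, m2, m3⟩ := hS.mem v hv
          simp only [Finset.mem_erase]
          exact ⟨⟨fun h' => m2 (h' ▸ hh), fun h' => hvh (by rw [← m3, h', hgv]), m1⟩,
            fun h' => m2 h'.2, m3⟩
      · simp only [Finset.mem_erase] at hk
        have hkL' : k ∉ L := fun hL => hkL (Finset.mem_erase.2 ⟨hk.1, hL⟩)
        have := hS.slot_vert k hk.2.2 hkL'
        have hne : vert k ≠ vert h := fun hv => hk.2.1 (by rw [← this, hv, hgs])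
        rw [Function.update_of_ne hne, this]
    refine ⟨(E.erase g).erase h, ?_, hslots, ?_⟩
    · by_cases he : D.other g = h
      · simpa [Paths.attach, he] using hD.close hgE hE hgh hgv (hτ _) he
      · simpa [Paths.attach, he, hg] using hD.join hgE hE hgh hgv (hτ _) he hq
    · intro k hk
      by_cases he : D.other g = h
      · simpa [Paths.attach, he] using hk
      · simp [Paths.attach, he, hg, Paths.join, Function.update_apply, hk]

theorem Slots.addEdge (hD : D.Valid vert τ q O E) (hS : Slots vert slot E ∅) :
    Slots vert slot (insert (2 * (q + 1)) (insert (2 * (q + 1) + 1) E))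
      {2 * (q + 1), 2 * (q + 1) + 1} := by
  have hle := hD.le_of_mem
  refine ⟨fun k hk => ?_, fun v hv => ?_, fun k hk hkL => hS.slot_vert k ?_ (by simp)⟩
  · simp only [Finset.mem_insert, Finset.mem_singleton] at *; tauto
  · obtain ⟨m1, m2, m3⟩ := hS.mem v hv
    have := hle _ m1
    simp only [Finset.mem_insert, Finset.mem_singleton]
    exact ⟨by tauto, by omega, m3⟩
  · simp only [Finset.mem_insert, Finset.mem_singleton] at *; tauto

/-- Signs that alternate along the trails and paths almost cancel out at every vertex. -/
theorem Valid.sum_vertex_le (hD : D.Valid vert τ q O E) (hS : Slots vert slot E ∅) {s : ℕ → ℤ}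
    (hs : D.Compatible s) (h1 : ∀ p, s p ≤ 1) (v : ℕ) :
    ∑ p ∈ O, ((if vert (2 * p) = v then 1 else 0) + (if vert (2 * p + 1) = v then 1 else 0)) * s p
      ≤ 1 := by
  rw [hD.sum s hs fun u => if u = v then 1 else 0]
  have hsub : E.filter (fun h => vert h = v) ⊆ {slot v} := fun h hh => by
    simp only [Finset.mem_filter] at hh
    simp [← hh.2, hS.slot_vert h hh.1]
  simp only [ite_mul, one_mul, zero_mul]
  rw [← Finset.sum_filter]
  calc _ ≤ ∑ h ∈ E.filter (fun h => vert h = v), (1 : ℤ) := Finset.sum_le_sum fun h _ => h1 _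
    _ = ((E.filter (fun h => vert h = v)).card : ℤ) := by simp
    _ ≤ 1 := by exact_mod_cast (Finset.card_le_card hsub).trans (by simp)

/-- If the sign of the root of every path makes the edge at one of the two ends positive, then the
sum of all signs is nonnegative. -/
theorem Valid.sum_nonneg (hD : D.Valid vert τ q O E) {s : ℕ → ℤ} (hs : D.Compatible s)
    (h1 : ∀ p, s p = 1 ∨ s p = -1)
    (hr : ∀ h ∈ E, ∃ k ∈ E, D.root k = D.root h ∧ s (D.root h) = (-1) ^ D.rel k) :
    0 ≤ ∑ p ∈ O, s p := by
  have key := hD.sum s hs fun _ => 1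
  have hinv : ∑ h ∈ E, s (h / 2) = ∑ h ∈ E, s (D.other h / 2) :=
    Finset.sum_nbij' D.other D.other hD.other_mem hD.other_mem hD.other_other hD.other_other
      fun h hh => by rw [hD.other_other h hh]
  have hpos : 0 ≤ ∑ h ∈ E, (s (h / 2) + s (D.other h / 2)) := by
    refine Finset.sum_nonneg fun h hh => ?_
    obtain ⟨k, hk, hkr, hks⟩ := hr h hh
    have hk1 : s (k / 2) = 1 := by
      rw [hD.sign s hs k hk, hkr, hks, ← mul_pow]; norm_num
    have := h1 (h / 2)
    have := h1 (D.other h / 2)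
    rcases hD.root_inj h hh k hk hkr with rfl | rfl <;> omega
  rw [Finset.sum_add_distrib, ← hinv] at hpos
  simp only [one_mul, ← Finset.mul_sum] at key
  omega

end Paths

/-- The new edge value after one round: half of `a`, rounded up if `σ = 0` and down if `σ = 1`. For
even `a` both are the same, so the sign of such an edge does not matter. -/
def halve (a σ : ℕ → ℕ) (p : ℕ) : ℕ := (a p + 1 - σ p) / 2

theorem two_mul_halve {a σ : ℕ → ℕ} (hσ : ∀ p, σ p ≤ 1) (p : ℕ) :
    2 * (halve a σ p : ℤ) = a p + if a p % 2 = 1 then (-1) ^ σ p else 0 := by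
  have := hσ p
  unfold halve
  generalize σ p = x at *
  interval_cases x <;> split_ifs <;> (simp; omega)

/-- The sum of `a` over the half-edges at `v`. -/
def degree (vert : ℕ → ℕ) (m : ℕ) (a : ℕ → ℕ) (v : ℕ) : ℕ :=
  ∑ p ∈ Finset.Icc 1 m,
    ((if vert (2 * p) = v then 1 else 0) + (if vert (2 * p + 1) = v then 1 else 0)) * a p

/-- The edges up to `m` with an odd value. -/
def oddEdges (a : ℕ → ℕ) (m : ℕ) : Finset ℕ := (Finset.Icc 1 m).filter fun p => a p % 2 = 1

theorem two_mul_degree_halve_le {D : Paths} {vert slot : ℕ → ℕ} {τ : ℕ → ℤ} {m : ℕ} {E : Finset ℕ}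
    {a σ : ℕ → ℕ} (hD : D.Valid vert τ m (oddEdges a m) E) (hS : Paths.Slots vert slot E ∅)
    (hσ : ∀ p, σ p ≤ 1) (hs : D.Compatible fun p => (-1) ^ σ p) (v : ℕ) :
    2 * degree vert m (halve a σ) v ≤ degree vert m a v + 1 := by
  have h1 : ∀ p, (-1 : ℤ) ^ σ p ≤ 1 := fun p => by
    rcases neg_one_pow_eq_or ℤ (σ p) with h | h <;> rw [h] <;> norm_num
  have key := hD.sum_vertex_le hS hs h1 v
  rw [oddEdges, Finset.sum_filter] at key
  rw [← Nat.cast_le (α := ℤ)]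
  unfold degree
  push_cast
  rw [Finset.mul_sum]
  have : ∀ p, 2 * (((if vert (2 * p) = v then (1 : ℤ) else 0) +
      if vert (2 * p + 1) = v then 1 else 0) * (halve a σ p : ℤ)) =
      ((if vert (2 * p) = v then 1 else 0) + if vert (2 * p + 1) = v then 1 else 0) * (a p : ℤ) +
      if a p % 2 = 1 then ((if vert (2 * p) = v then 1 else 0) +
        if vert (2 * p + 1) = v then 1 else 0) * (-1) ^ σ p else 0 := fun p => by
    rw [mul_left_comm, two_mul_halve hσ]
    split_ifs <;> ring
  rw [Finset.sum_congr rfl fun p _ => this p, Finset.sum_add_distrib]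
  linarith

theorem sum_le_two_mul_sum_halve {D : Paths} {vert : ℕ → ℕ} {τ : ℕ → ℤ} {m : ℕ} {E : Finset ℕ}
    {a σ : ℕ → ℕ} (hD : D.Valid vert τ m (oddEdges a m) E)
    (hσ : ∀ p, σ p ≤ 1) (hs : D.Compatible fun p => (-1) ^ σ p)
    (hr : ∀ h ∈ E, ∃ k ∈ E, D.root k = D.root h ∧ σ (D.root h) = D.rel k) :
    ∑ p ∈ Finset.Icc 1 m, a p ≤ 2 * ∑ p ∈ Finset.Icc 1 m, halve a σ p := by
  have key := hD.sum_nonneg hs (fun p => neg_one_pow_eq_or ℤ (σ p)) fun h hh => by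
    obtain ⟨k, hk, h1, h2⟩ := hr h hh
    exact ⟨k, hk, h1, by simp only [h2]⟩
  rw [oddEdges, Finset.sum_filter] at key
  zify
  rw [Finset.mul_sum]
  simp only [two_mul_halve hσ, Finset.sum_add_distrib]
  linarith

end RealRAM

/-! ### The program: insertion of the odd edges -/

namespace RealRAM

/-- The constants in registers and the arrays that do not change during the rounding: the number
of edges `m`, the current power of two `K`, the vertices `vert h` of the half-edges, the integral
parts `y`, and the sum `S` of the input. Registers `5` and `8` count edges and half-edges, and the
registers from `9` on are for temporary use, except for `18` in `signAllCmd`. Edges are numbered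
from `1` in all arrays but the input and the output. -/
structure Base (m K : ℕ) (vert y : ℕ → ℕ) (S : ℝ) (s : Store) : Prop where
  reg1 : s.reg 1 = m
  reg2 : s.reg 2 = 0
  reg3 : s.reg 3 = 1
  reg4 : s.reg 4 = 2
  reg6 : s.reg 6 = m + 1
  reg7 : s.reg 7 = K
  mem3 : s.mem 3 = y
  mem12 : s.mem 12 = vert
  rreg1 : s.rreg 1 = S

/-- The paths that are stored in the word arrays `6`, …, `10`. -/
def Store.paths (s : Store) : Paths := ⟨s.mem 6, s.mem 7, s.mem 8, s.mem 9, s.mem 10⟩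

/-- Attach the half-edge in register `8` to its vertex; register `5` holds its edge. Word array `5`
holds the waiting half-edges. -/
def attachCmd : Cmd :=
  .seq (.ops [.load 9 12 8, .load 10 5 9]) <|
  .ite (.word 2 10)
    (.seq (.ops [.store 5 9 2, .load 11 6 10, .sub 12 11 8, .sub 13 8 11, .add 12 12 13]) <|
      .ite (.word 2 12)
        (.ops [.load 13 7 10, .load 14 6 8, .load 15 8 10, .load 16 8 8, .sub 17 15 16,
          .sub 16 16 15, .add 17 17 16, .sub 17 3 17, .store 9 13 5, .store 10 13 17,
          .load 15 8 11, .sub 16 15 17, .sub 17 17 15, .add 16 16 17, .store 8 11 16,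
          .store 7 11 5, .store 6 11 14, .store 6 14 11])
        (.ops []))
    (.ops [.store 5 9 8])

variable {w m K : ℕ} {vert y : ℕ → ℕ} {S : ℝ} {s : Store}

theorem wp_attachCmd {i h : ℕ} (hB : Base m K vert y S s) (h5 : s.reg 5 = i) (h8 : s.reg 8 = h)
    (hw : 2 ≤ 2 ^ w) (hh : h < 2 ^ w) (hv : vert h < 2 ^ w) (hg : s.mem 5 (vert h) < 2 ^ w)
    (hb : s.mem 5 (vert h) ≠ 0 → s.mem 6 (s.mem 5 (vert h)) < 2 ^ w ∧
      s.mem 7 (s.mem 5 (vert h)) < 2 ^ w ∧ s.mem 6 h < 2 ^ w ∧ s.mem 8 (s.mem 5 (vert h)) ≤ 1 ∧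
      s.mem 8 h ≤ 1 ∧ s.mem 8 (s.mem 6 (s.mem 5 (vert h))) ≤ 1) :
    wp w attachCmd (fun s' => Base m K vert y S s' ∧ s'.reg 5 = i ∧ s'.reg 8 = h ∧
      s'.mem 4 = s.mem 4 ∧ s'.mem 11 = s.mem 11 ∧
      s'.paths = s.paths.attach i (s.mem 5 (vert h)) h ∧
      s'.mem 5 = Function.update (s.mem 5) (vert h) (Paths.newSlot (s.mem 5 (vert h)) h)) s := by
  simp only [attachCmd, wp, wpOps, Store.setReg, Store.setMem, State.setEntry, Test.Holds,
    Function.update_self, ne_eq, Nat.reduceEqDiff, not_false_eq_true,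
    Function.update_of_ne, hB.reg2, hB.reg3, hB.mem12, h5, h8]
  generalize hgd : s.mem 5 (vert h) = g at *
  refine ⟨hv, hg, fun hg0 => ⟨(hb hg0.ne').1, by have := (hb hg0.ne').1; omega, by omega,
    by have := (hb hg0.ne').1; omega, fun hne => ?_, fun hne => ?_⟩, fun hg0 => ?_⟩
  · obtain ⟨b1, b2, b3, b4, b5, b6⟩ := hb hg0.ne'
    have e : s.mem 6 g ≠ h := by omega
    refine ⟨b2, b3, by omega, by omega, by omega, by omega, by omega, by omega, by omega,
      by omega, by omega, by omega, ⟨?_, trivial, trivial, trivial, trivial, ?_, ?_⟩⟩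
    · constructor <;> simp [hB.reg1, hB.reg2, hB.reg3, hB.reg4, hB.reg6, hB.reg7, hB.mem3,
        hB.mem12, hB.rreg1]
    · simp [Store.paths, Paths.attach, Paths.join, hg0.ne', e]
    · simp [Paths.newSlot, hg0.ne']
  · have e : s.mem 6 g = h := by omega
    refine ⟨?_, trivial, trivial, trivial, trivial, ?_, ?_⟩
    · constructor <;> simp [hB.reg1, hB.reg2, hB.reg3, hB.reg4, hB.reg6, hB.reg7, hB.mem3,
        hB.mem12, hB.rreg1]
    · simp [Store.paths, Paths.attach, e]
    · simp [Paths.newSlot, hg0.ne']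
  · have e : g = 0 := by omega
    refine ⟨?_, trivial, trivial, trivial, trivial, ?_, ?_⟩
    · constructor <;> simp [hB.reg1, hB.reg2, hB.reg3, hB.reg4, hB.reg6, hB.reg7, hB.mem3,
        hB.mem12, hB.rreg1]
    · simp [Store.paths, Paths.attach, e]
    · simp [Paths.newSlot, e]

/-- The state of the insertion of the odd edges, when those in `O` have been inserted, the last one
of them is `i`, and its half-edges in `L` have not been attached to their vertices. -/
structure Inserting (m K : ℕ) (vert y : ℕ → ℕ) (S : ℝ) (τ : ℕ → ℤ) (a σ : ℕ → ℕ) (i : ℕ)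
    (O E L : Finset ℕ) (s : Store) : Prop where
  base : Base m K vert y S s
  mem4 : s.mem 4 = a
  mem11 : s.mem 11 = σ
  valid : s.paths.Valid vert τ i O E
  slots : Paths.Slots vert (s.mem 5) E L
  root : ∀ h ∈ L, s.paths.root h = i

variable {τ : ℕ → ℤ} {a σ : ℕ → ℕ} {i : ℕ} {O E L : Finset ℕ}

theorem Inserting.wp_attachCmd {h : ℕ} (hI : Inserting m K vert y S τ a σ i O E L s)
    (h5 : s.reg 5 = i) (h8 : s.reg 8 = h) (hh : h ∈ L) (hτ : ∀ v, τ v * τ v = 1)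
    (hw : 2 * i + 2 ≤ 2 ^ w) (hv : vert h < 2 ^ w) :
    wp w attachCmd (fun s' => s'.reg 5 = i ∧
      ∃ E', Inserting m K vert y S τ a σ i O E' (L.erase h) s') s := by
  obtain ⟨hB, h4, h11, hV, hS, hr⟩ := hI
  have hE := hS.subset hh
  have l1 := hV.le_of_mem
  have l2 := hV.root_le
  have l3 := hV.rel_le
  have hsg : s.mem 5 (vert h) ≠ 0 → s.mem 5 (vert h) ∈ E := fun hg => (hS.mem _ hg).1
  have hi1 : 1 ≤ i := hr h hh ▸ hV.root_pos h hE
  refine wp_mono (RealRAM.wp_attachCmd hB h5 h8 (by omega) (by have := l1 h hE; omega) hv ?_ ?_) ?_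
  · by_cases hg : s.mem 5 (vert h) = 0
    · rw [hg]; omega
    · have := l1 _ (hsg hg); omega
  · intro hg
    have hgE := hsg hg
    have hag := hV.other_mem _ hgE
    have hbh := hV.other_mem _ hE
    exact ⟨by have := l1 _ hag; exact this.trans_lt (by omega),
      by have := l2 _ hgE; exact this.trans_lt (by omega),
      by have := l1 _ hbh; exact this.trans_lt (by omega), l3 _ hgE, l3 _ hE, l3 _ hag⟩
  · rintro s' ⟨hB', h5', h8', h4', h11', hp', hs'⟩
    obtain ⟨E', hV', hS', hr'⟩ := hV.attach hS hh hτ (hr h hh)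
    refine ⟨h5', E', hB', h4'.trans h4, h11'.trans h11, hp' ▸ hV', hs' ▸ hS', fun k hk => ?_⟩
    rw [hp']
    exact hr' k (hr k (Finset.mem_of_mem_erase hk))

/-- Insert the edge `i` in register `5` if its value is odd, and go to the next edge. -/
def insertCmd : Cmd :=
  .seq (.ops [.load 9 4 5, .div 10 9 4, .mul 10 10 4]) <|
  .seq (.ite (.word 10 9)
    (.seq (.ops [.mul 8 4 5, .add 9 8 3, .store 6 8 9, .store 6 9 8, .store 7 8 5, .store 7 9 5,
        .store 8 8 2, .store 8 9 2]) <|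
      .seq attachCmd <| .seq (.ops [.mul 8 4 5, .add 8 8 3]) attachCmd)
    (.ops [])) <|
  .ops [.add 5 5 3]

theorem oddEdges_succ (a : ℕ → ℕ) (i : ℕ) : oddEdges a (i + 1) =
    if a (i + 1) % 2 = 1 then insert (i + 1) (oddEdges a i) else oddEdges a i := by
  ext p
  simp only [oddEdges]
  split_ifs with h <;> simp only [Finset.mem_insert, Finset.mem_filter, Finset.mem_Icc] <;> grind

theorem not_mem_oddEdges (a : ℕ → ℕ) (i : ℕ) : i + 1 ∉ oddEdges a i := by
  simp [oddEdges]

theorem Inserting.wp_insertCmd (hI : Inserting m K vert y S τ a σ i (oddEdges a i) E ∅ s)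
    (h5 : s.reg 5 = i + 1) (hτ : ∀ v, τ v * τ v = 1)
    (he : τ (vert (2 * (i + 1))) * τ (vert (2 * (i + 1) + 1)) = -1)
    (hw : 2 * (i + 1) + 2 ≤ 2 ^ w) (hv : ∀ h, vert h < 2 ^ w) (ha : a (i + 1) < 2 ^ w) :
    wp w insertCmd (fun s' => s'.reg 5 = i + 2 ∧
      ∃ E', Inserting m K vert y S τ a σ (i + 1) (oddEdges a (i + 1)) E' ∅ s') s := by
  obtain ⟨hB, h4, h11, hV, hS, hr⟩ := hI
  -- the increment of the counter at the end
  have fin : ∀ s₁ : Store, s₁.reg 5 = i + 1 →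
      (∃ E', Inserting m K vert y S τ a σ (i + 1) (oddEdges a (i + 1)) E' ∅ s₁) →
      wp w (.ops [.add 5 5 3]) (fun s' => s'.reg 5 = i + 2 ∧
        ∃ E', Inserting m K vert y S τ a σ (i + 1) (oddEdges a (i + 1)) E' ∅ s') s₁ := by
    rintro s₁ h5' ⟨E', hB', h4', h11', hV', hS', hr'⟩
    simp only [wp, wpOps, Store.setReg, h5', hB'.reg3, Function.update_self]
    refine ⟨by omega, trivial, E', ?_, h4', h11', hV', hS', hr'⟩
    constructor <;> simp [hB'.reg1, hB'.reg2, hB'.reg3, hB'.reg4, hB'.reg6, hB'.reg7, hB'.mem3,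
        hB'.mem12, hB'.rreg1]
  simp only [insertCmd, wp, wpOps, Store.setReg, Store.setMem, State.setEntry, Test.Holds,
    Function.update_self, ne_eq, Nat.reduceEqDiff, not_false_eq_true,
    Function.update_of_ne, hB.reg2, hB.reg3, hB.reg4, h5, h4]
  refine ⟨ha, by omega, by omega, fun hodd => ⟨by omega, by omega, ?_⟩, fun heven => ?_⟩
  · have hodd : a (i + 1) % 2 = 1 := by omega
    refine wp_mono (Inserting.wp_attachCmd (m := m) (K := K) (y := y) (S := S) (τ := τ)
      (a := a) (σ := σ) (i := i + 1)
      (h := 2 * (i + 1)) (L := {2 * (i + 1), 2 * (i + 1) + 1})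
      ⟨?_, ?_, ?_, hV.addEdge (not_mem_oddEdges a i) he, Paths.Slots.addEdge hV hS, ?_⟩
      ?_ ?_ (by simp) hτ hw (hv _)) ?_
    · constructor <;> simp [hB.reg1, hB.reg2, hB.reg3, hB.reg4, hB.reg6, hB.reg7, hB.mem3,
        hB.mem12, hB.rreg1]
    · simp [h4]
    · simp [h11]
    · simp [Store.paths, Function.update_apply]
    · simp [h5]
    · simp
    · rintro s₂ ⟨h5', E₂, hI⟩
      have e : ({2 * (i + 1), 2 * (i + 1) + 1} : Finset ℕ).erase (2 * (i + 1)) =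
          {2 * (i + 1) + 1} := by
        ext k; simp only [Finset.mem_erase, Finset.mem_insert, Finset.mem_singleton]; omega
      rw [e] at hI
      obtain ⟨hB', h4', h11', hV', hS', hr'⟩ := hI
      simp only [h5', hB'.reg3, hB'.reg4]
      refine ⟨by omega, by omega, ?_⟩
      refine wp_mono (Inserting.wp_attachCmd (m := m) (K := K) (y := y) (S := S) (τ := τ)
      (a := a) (σ := σ) (i := i + 1)
        (h := 2 * (i + 1) + 1) (L := {2 * (i + 1) + 1}) ⟨?_, h4', h11', hV', hS', hr'⟩
        ?_ ?_ (by simp) hτ hw (hv _)) ?_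
      · constructor <;> simp [hB'.reg1, hB'.reg2, hB'.reg3, hB'.reg4, hB'.reg6, hB'.reg7,
          hB'.mem3, hB'.mem12, hB'.rreg1]
      · simp [h5']
      · simp
      · rintro s₃ ⟨h5'', E₃, hI⟩
        rw [Finset.erase_singleton] at hI
        refine fin s₃ h5'' ⟨E₃, ?_⟩
        rwa [oddEdges_succ, if_pos hodd]
  · have heven : ¬ a (i + 1) % 2 = 1 := by omega
    refine ⟨by omega, trivial, E, ?_, h4, h11, ?_, hS, by simp⟩
    · constructor <;> simp [hB.reg1, hB.reg2, hB.reg3, hB.reg4, hB.reg6, hB.reg7, hB.mem3,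
        hB.mem12, hB.rreg1]
    · rw [oddEdges_succ, if_neg heven]
      exact hV.mono (by omega)

end RealRAM

/-! ### The program: signs of the edges, and a whole round -/

namespace RealRAM

variable {w m K : ℕ} {vert y : ℕ → ℕ} {S : ℝ} {s : Store} {τ : ℕ → ℤ} {a σ : ℕ → ℕ} {i : ℕ}
  {O E L : Finset ℕ}

/-- Insert all edges with an odd value. -/
def insertAllCmd : Cmd := .seq (.ops [.add 5 3 2]) (.loop (.word 5 6) insertCmd)

theorem spec_insertAllCmd (hB : Base m K vert y S s) (h4 : s.mem 4 = a) (h11 : s.mem 11 = σ)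
    (hslot : ∀ v, s.mem 5 v = 0) (hpar : ∀ p, s.mem 9 p = 0) (hτ : ∀ v, τ v * τ v = 1)
    (he : ∀ i < m, τ (vert (2 * (i + 1))) * τ (vert (2 * (i + 1) + 1)) = -1)
    (hw : 2 * m + 2 ≤ 2 ^ w) (hv : ∀ h, vert h < 2 ^ w) (ha : ∀ p, a p < 2 ^ w) :
    Spec w insertAllCmd (1 + (m * (insertCmd.cost + 2) + 2)) s
      fun s' => ∃ E, Inserting m K vert y S τ a σ m (oddEdges a m) E ∅ s' := by
  refine Spec.seq (Spec.mono (spec_ops (Q := fun s' => s'.reg 5 = 0 + 1 ∧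
    ∃ E, Inserting m K vert y S τ a σ 0 (oddEdges a 0) E ∅ s') ?_) le_rfl fun s' h' => ?_)
  · have e : oddEdges a 0 = ∅ := by simp [oddEdges]
    simp only [wpOps, Store.setReg, hB.reg2, hB.reg3]
    refine ⟨by have := Nat.one_le_two_pow (n := w); omega, by simp, ∅, ?_, h4, h11, ?_, ?_, by simp⟩
    · constructor <;> simp [hB.reg1, hB.reg2, hB.reg3, hB.reg4, hB.reg6, hB.reg7, hB.mem3,
        hB.mem12, hB.rreg1]
    · rw [e]; exact Paths.valid_empty hpar
    · exact ⟨by simp, fun v h => absurd (hslot v) h, by simp⟩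
  · refine Spec.mono (Spec.loop (fun j s' => s'.reg 5 = j + 1 ∧
      ∃ E, Inserting m K vert y S τ a σ j (oddEdges a j) E ∅ s') h' ?_ ?_) le_rfl fun s h => h.2
    · rintro j s ⟨h5, E, hI⟩
      simp only [Test.Holds, h5, hI.base.reg6]
      omega
    · rintro j s hj ⟨h5, E, hI⟩
      exact spec_of_wp (hI.wp_insertCmd h5 hτ (he j hj) (by omega) hv (ha _))

/-- If a half-edge is waiting at the vertex of the half-edge in register `8`, give the root of its
path the sign that makes the waiting edge positive, and clear the vertex. Word array `11` holds
the signs. -/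
def signCmd : Cmd :=
  .seq (.ops [.load 9 12 8, .load 10 5 9]) <|
  .seq (.ite (.word 2 10) (.ops [.load 11 7 10, .load 12 8 10, .store 11 11 12, .store 5 9 2])
    (.ops [])) <|
  .ops [.add 8 8 3]

/-- Choose the signs of the roots. -/
def signAllCmd : Cmd := .seq (.ops [.mul 18 4 6, .add 8 4 2]) (.loop (.word 8 18) signCmd)

/-- The state of the choice of the signs of the roots, when the vertices of the half-edges `h` with
`2 ≤ h < k` have been cleared. -/
structure Signing (m K : ℕ) (vert y : ℕ → ℕ) (S : ℝ) (a : ℕ → ℕ) (D : Paths) (E : Finset ℕ)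
    (slot : ℕ → ℕ) (k : ℕ) (s : Store) : Prop where
  base : Base m K vert y S s
  mem4 : s.mem 4 = a
  paths : s.paths = D
  reg8 : s.reg 8 = k
  reg18 : s.reg 18 = 2 * (m + 1)
  slot_eq : ∀ v, s.mem 5 v = slot v ∨ s.mem 5 v = 0
  cleared : ∀ h, 2 ≤ h → h < k → s.mem 5 (vert h) = 0
  sign_le : ∀ p, s.mem 11 p ≤ 1
  sign_root : ∀ h ∈ E, s.mem 5 (vert h) = 0 →
    ∃ k ∈ E, D.root k = D.root h ∧ s.mem 11 (D.root h) = D.rel k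

theorem Signing.wp_signCmd {D : Paths} {slot : ℕ → ℕ} {k : ℕ}
    (hI : Signing m K vert y S a D E slot k s) (hD : D.Valid vert τ m O E)
    (hS : Paths.Slots vert slot E ∅) (hk : k < 2 * m + 2) (hw : 2 * m + 2 < 2 ^ w)
    (hv : ∀ h, vert h < 2 ^ w) : wp w signCmd (Signing m K vert y S a D E slot (k + 1)) s := by
  obtain ⟨hB, h4, hp, h8, h18, hsl, hcl, hsg, hsr⟩ := hI
  have hgE : s.mem 5 (vert k) ≠ 0 → s.mem 5 (vert k) ∈ E := fun h => by
    rcases hsl (vert k) with h' | h'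
    · rw [h'] at h ⊢; exact (hS.mem _ h).1
    · exact absurd h' h
  have h7 : s.mem 7 = D.root := by rw [← hp]; rfl
  have h8' : s.mem 8 = D.rel := by rw [← hp]; rfl
  simp only [signCmd, wp, wpOps, Store.setReg, Store.setMem, State.setEntry, Test.Holds,
    Function.update_self, ne_eq, Nat.reduceEqDiff, not_false_eq_true,
    Function.update_of_ne, hB.reg2, hB.reg3, hB.mem12, h8]
  refine ⟨hv k, ?_, fun hg => ?_, fun hg => ⟨by omega, ?_⟩⟩
  · by_cases hg : s.mem 5 (vert k) = 0
    · rw [hg]; omega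
    · have := hD.le_of_mem _ (hgE hg); omega
  · have hgE := hgE hg.ne'
    have hgs : slot (vert k) = s.mem 5 (vert k) := (hsl _).resolve_right hg.ne' |>.symm
    have hgv : vert (s.mem 5 (vert k)) = vert k := by
      have := (hS.mem (vert k) (by omega)).2.2
      rwa [hgs] at this
    generalize s.mem 5 (vert k) = g at *
    rw [h7, h8']
    have r1 := hD.root_le g hgE
    have r2 := hD.rel_le g hgE
    refine ⟨by omega, by omega, by omega, ?_⟩
    constructor
    case base =>
      constructor <;> simp [hB.reg1, hB.reg2, hB.reg3, hB.reg4, hB.reg6, hB.reg7, hB.mem3,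
        hB.mem12, hB.rreg1]
    case mem4 => simpa using h4
    case paths => simpa [Store.paths] using hp
    case reg8 => simp
    case reg18 => simpa using h18
    case slot_eq =>
      intro v
      by_cases hvk : v = vert k
      · right; simp [hvk]
      · simpa [Function.update_of_ne hvk] using hsl v
    case cleared =>
      intro h hh2 hhk
      by_cases hvk : vert h = vert k
      · simp [hvk]
      · have : h < k := lt_of_le_of_ne (by omega) fun he => hvk (by rw [he])
        simpa [Function.update_of_ne hvk] using hcl h hh2 this
    case sign_le =>
      intro p
      by_cases hpg : p = D.root g
      · simpa [hpg] using r2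
      · simpa [Function.update_of_ne hpg] using hsg p
    case sign_root =>
      intro h hh h0
      by_cases hrg : D.root h = D.root g
      · exact ⟨g, hgE, hrg.symm, by simp [hrg]⟩
      · have hvk : vert h ≠ vert k := fun hvk => hrg <| by
          have := hS.slot_vert h hh (by simp)
          rw [hvk, hgs] at this
          rw [this]
        have h0' : s.mem 5 (vert h) = 0 := by simpa [Function.update_of_ne hvk] using h0
        simpa [Function.update_of_ne hrg] using hsr h hh h0'
  · have hg : s.mem 5 (vert k) = 0 := by omega
    constructor
    case base =>
      constructor <;> simp [hB.reg1, hB.reg2, hB.reg3, hB.reg4, hB.reg6, hB.reg7, hB.mem3,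
        hB.mem12, hB.rreg1]
    case mem4 => exact h4
    case paths => exact hp
    case reg8 => simp
    case reg18 => simpa using h18
    case slot_eq => exact hsl
    case cleared =>
      intro h hh2 hhk
      rcases Nat.lt_succ_iff_lt_or_eq.1 hhk with hk | rfl
      · exact hcl h hh2 hk
      · exact hg
    case sign_le => exact hsg
    case sign_root => exact hsr

theorem spec_signAllCmd {D : Paths} {slot : ℕ → ℕ} (hB : Base m K vert y S s) (h4 : s.mem 4 = a)
    (hp : s.paths = D) (h5 : s.mem 5 = slot) (hσ : ∀ p, s.mem 11 p ≤ 1)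
    (hD : D.Valid vert τ m O E) (hS : Paths.Slots vert slot E ∅) (hw : 2 * m + 2 < 2 ^ w)
    (hv : ∀ h, vert h < 2 ^ w) :
    Spec w signAllCmd (2 + (2 * m * (signCmd.cost + 2) + 2)) s
      (Signing m K vert y S a D E slot (2 * m + 2)) := by
  refine Spec.seq (Spec.mono (spec_ops (Q := Signing m K vert y S a D E slot (0 + 2)) ?_) le_rfl
    fun s' h' => ?_)
  · simp only [wpOps, Store.setReg, ne_eq, Nat.reduceEqDiff, not_false_eq_true,
      Function.update_of_ne, hB.reg2, hB.reg4, hB.reg6]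
    refine ⟨by omega, by omega, ?_⟩
    constructor
    case base =>
      constructor <;> simp [hB.reg1, hB.reg2, hB.reg3, hB.reg4, hB.reg6, hB.reg7, hB.mem3,
        hB.mem12, hB.rreg1]
    case mem4 => exact h4
    case paths => exact hp
    case reg8 => simp
    case reg18 => simp
    case slot_eq => exact fun v => Or.inl (congrFun h5 v)
    case cleared => exact fun h h1 h2 => by omega
    case sign_le => exact hσ
    case sign_root =>
      intro h hh h0
      have h1 := hS.slot_vert h hh (by simp)
      have h2 := hD.two_le_of_mem h hh
      have h3 := congrFun h5 (vert h)
      simp only at h0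
      omega
  · refine Spec.loop (fun j s' => Signing m K vert y S a D E slot (j + 2) s') h' ?_ ?_
    · intro j s hI
      simp only [Test.Holds, hI.reg8, hI.reg18]
      omega
    · intro j s hj hI
      exact spec_of_wp (hI.wp_signCmd hD hS (by omega) hw hv)

/-- Compute the sign of the edge in register `5` from that of its parent, if there is one, clear
the parent, round half the value of the edge according to the sign, and go to the previous edge. -/
def halveCmd : Cmd :=
  .seq (.ops [.load 9 9 5, .load 11 11 5]) <|
  .seq (.ite (.word 2 9) (.ops [.load 10 10 5, .load 11 11 9, .sub 12 10 11, .sub 13 11 10,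
    .add 11 12 13, .store 11 5 11, .store 9 5 2]) (.ops [])) <|
  .ops [.load 9 4 5, .add 9 9 3, .sub 9 9 11, .div 9 9 4, .store 4 5 9, .sub 5 5 3]

/-- Compute the signs of all edges, and round half of all values accordingly. -/
def halveAllCmd : Cmd := .seq (.ops [.add 5 1 2]) (.loop (.word 2 5) halveCmd)

/-- The state of the computation of the signs, when the edges after `k` have been treated. -/
structure Halving (m K : ℕ) (vert y : ℕ → ℕ) (S : ℝ) (a : ℕ → ℕ) (D : Paths) (σ : ℕ → ℕ)
    (k : ℕ) (s : Store) : Prop where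
  base : Base m K vert y S s
  reg5 : s.reg 5 = k
  slot_eq : ∀ v, s.mem 5 v = 0
  mem10 : s.mem 10 = D.flip
  par_eq : ∀ p, s.mem 9 p = if k < p then 0 else D.par p
  sign_le : ∀ p, s.mem 11 p ≤ 1
  sign_eq : ∀ p, p ≤ k ∨ D.par p = 0 → s.mem 11 p = σ p
  sign_par : ∀ p, k < p → D.par p ≠ 0 → s.mem 11 p =
    D.flip p - s.mem 11 (D.par p) + (s.mem 11 (D.par p) - D.flip p)
  val_eq : ∀ p, s.mem 4 p = if k < p ∧ p ≤ m then halve a (s.mem 11) p else a p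

theorem Halving.wp_halveCmd {D : Paths} {k : ℕ} (hI : Halving m K vert y S a D σ (k + 1) s)
    (hD : D.Valid vert τ m O E) (hk : k < m) (hw : 2 * m + 2 < 2 ^ w)
    (ha : ∀ p, a p + 1 < 2 ^ w) : wp w halveCmd (Halving m K vert y S a D σ k) s := by
  obtain ⟨hB, h5, hsl, h10, hpar, hsg, hsq, hsp, hva⟩ := hI
  have h9 : s.mem 9 (k + 1) = D.par (k + 1) := by rw [hpar]; simp
  have h4 : s.mem 4 (k + 1) = a (k + 1) := by rw [hva]; simp
  have hpl := hD.par_le (k + 1)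
  have hs1 := hsg (k + 1)
  have ha1 := ha (k + 1)
  have hdiv : ∀ x, (a (k + 1) + 1 - x) / 2 < 2 ^ w := fun x =>
    (Nat.div_le_self _ _).trans_lt (by omega)
  simp only [halveCmd, wp, wpOps, Store.setReg, Store.setMem, State.setEntry, Test.Holds,
    Function.update_self, ne_eq, Nat.reduceEqDiff, not_false_eq_true,
    Function.update_of_ne, hB.reg2, hB.reg3, hB.reg4, h5, h9, h4, h10]
  refine ⟨by omega, by omega, fun hp => ?_, fun hp => ?_⟩
  · have hlt := hD.lt_par (k + 1) hp.ne'
    have hfl := hD.flip_le (k + 1) hp.ne'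
    have hs2 := hsg (D.par (k + 1))
    refine ⟨by omega, by omega, by omega, by omega, by omega, by omega, by omega, by omega,
      hdiv _, by omega, ?_⟩
    have hne : D.par (k + 1) ≠ k + 1 := by omega
    have hpne : ∀ p, k + 1 < p → D.par p ≠ 0 → D.par p ≠ k + 1 := fun p h1 h2 => by
      have := hD.lt_par p h2; omega
    constructor
    case base =>
      constructor <;> simp [hB.reg1, hB.reg2, hB.reg3, hB.reg4, hB.reg6, hB.reg7, hB.mem3,
        hB.mem12, hB.rreg1]
    case reg5 => simp
    case slot_eq => simpa using hsl
    case mem10 => simpa using h10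
    case par_eq =>
      intro p
      by_cases hpk : p = k + 1
      · simp [hpk]
      · have : k < p ↔ k + 1 < p := by omega
        simp [Function.update_of_ne hpk, hpar, this]
    case sign_le =>
      intro p
      by_cases hpk : p = k + 1
      · simp [hpk]; omega
      · simpa [Function.update_of_ne hpk] using hsg p
    case sign_eq =>
      intro p hpp
      have hpk : p ≠ k + 1 := by rintro rfl; omega
      simpa [Function.update_of_ne hpk] using hsq p (by omega)
    case sign_par =>
      intro p hkp hpp
      by_cases hpk : p = k + 1
      · simp [hpk, Function.update_of_ne hne]
      · have := hsp p (by omega) hpp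
        simpa [Function.update_of_ne hpk, Function.update_of_ne (hpne p (by omega) hpp)] using this
    case val_eq =>
      intro p
      by_cases hpk : p = k + 1
      · have : k + 1 ≤ m := hk
        simp [hpk, this, halve]
      · have : k < p ↔ k + 1 < p := by omega
        simp [Function.update_of_ne hpk, hva, this, halve]
  · have hp : D.par (k + 1) = 0 := by omega
    refine ⟨by omega, by omega, by omega, hdiv _, by omega, ?_⟩
    constructor
    case base =>
      constructor <;> simp [hB.reg1, hB.reg2, hB.reg3, hB.reg4, hB.reg6, hB.reg7, hB.mem3,
        hB.mem12, hB.rreg1]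
    case reg5 => simp
    case slot_eq => simpa using hsl
    case mem10 => simpa using h10
    case par_eq =>
      intro p
      by_cases hpk : p = k + 1
      · simp [hpk, h9, hp]
      · have : k < p ↔ k + 1 < p := by omega
        simp [hpar, this]
    case sign_le => simpa using hsg
    case sign_eq =>
      intro p hpp
      simpa using hsq p (by omega)
    case sign_par =>
      intro p hkp hpp
      have hpk : p ≠ k + 1 := by rintro rfl; omega
      simpa using hsp p (by omega) hpp
    case val_eq =>
      intro p
      by_cases hpk : p = k + 1
      · have : k + 1 ≤ m := hk
        simp [hpk, this, halve]
      · have : k < p ↔ k + 1 < p := by omega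
        simp [Function.update_of_ne hpk, hva, this, halve]

theorem spec_halveAllCmd {D : Paths} (hB : Base m K vert y S s) (h4 : s.mem 4 = a)
    (hp : s.paths = D) (h5 : ∀ v, s.mem 5 v = 0) (h11 : s.mem 11 = σ) (hσ : ∀ p, s.mem 11 p ≤ 1)
    (hD : D.Valid vert τ m O E) (hw : 2 * m + 2 < 2 ^ w) (ha : ∀ p, a p + 1 < 2 ^ w) :
    Spec w halveAllCmd (1 + (m * (halveCmd.cost + 2) + 2)) s (Halving m K vert y S a D σ 0) := by
  have hpm : ∀ p, D.par p ≠ 0 → p < m := fun p h => (hD.lt_par p h).trans_le (hD.par_le p)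
  refine Spec.seq (Spec.mono (spec_ops (Q := Halving m K vert y S a D σ (m - 0)) ?_) le_rfl
    fun s' h' => ?_)
  · simp only [wpOps, Store.setReg, hB.reg1, hB.reg2]
    refine ⟨by omega, ?_⟩
    constructor
    case base =>
      constructor <;> simp [hB.reg1, hB.reg2, hB.reg3, hB.reg4, hB.reg6, hB.reg7, hB.mem3,
        hB.mem12, hB.rreg1]
    case reg5 => simp
    case slot_eq => exact h5
    case mem10 => rw [← hp]; rfl
    case par_eq =>
      intro p
      have e : s.mem 9 p = D.par p := by rw [← hp]; rfl
      have := hpm p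
      simp only [e]
      split_ifs <;> omega
    case sign_le => exact hσ
    case sign_eq => exact fun p _ => congrFun h11 p
    case sign_par => exact fun p h1 h2 => absurd (hpm p h2) (by omega)
    case val_eq =>
      intro p
      rw [if_neg (by omega)]
      exact congrFun h4 p
  · refine Spec.mono (Spec.loop (fun j s' => j ≤ m ∧ Halving m K vert y S a D σ (m - j) s')
      ⟨by omega, h'⟩ ?_ ?_) le_rfl fun s h => by simpa using h.2
    · rintro j s ⟨hj, hI⟩
      simp only [Test.Holds, hI.reg5, hI.base.reg2]
      omega
    · rintro j s hj ⟨-, hI⟩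
      rw [show m - j = m - (j + 1) + 1 by omega] at hI
      exact (spec_of_wp (hI.wp_halveCmd hD (by omega) hw ha)).mono le_rfl fun s h => ⟨by omega, h⟩

/-- One round: round the halves of all values. -/
def roundCmd : Cmd := .seq insertAllCmd <| .seq signAllCmd halveAllCmd

/-- The state between two rounds, with the edge values `a`. -/
structure Rounding (m K : ℕ) (vert y : ℕ → ℕ) (S : ℝ) (a : ℕ → ℕ) (s : Store) : Prop where
  base : Base m K vert y S s
  mem4 : s.mem 4 = a
  slot_eq : ∀ v, s.mem 5 v = 0
  par_eq : ∀ p, s.mem 9 p = 0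
  sign_le : ∀ p, s.mem 11 p ≤ 1

/-- A bound on the number of steps of a round. -/
def roundCost (m : ℕ) : ℕ :=
  1 + (m * (insertCmd.cost + 2) + 2) + (2 + (2 * m * (signCmd.cost + 2) + 2) +
    (1 + (m * (halveCmd.cost + 2) + 2)))

theorem Rounding.spec_roundCmd {A : ℕ} (hI : Rounding m K vert y S a s) (hτ : ∀ v, τ v * τ v = 1)
    (he : ∀ i < m, τ (vert (2 * (i + 1))) * τ (vert (2 * (i + 1) + 1)) = -1)
    (hw : 2 * m + 2 < 2 ^ w) (hv : ∀ h, vert h < 2 ^ w) (ha : ∀ p, a p ≤ A) (hA1 : 1 ≤ A)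
    (hA : A + 1 < 2 ^ w) :
    Spec w roundCmd (roundCost m) s fun s' => ∃ a', Rounding m K vert y S a' s' ∧
      (∀ p, a' p ≤ A) ∧ (∀ v, 2 * degree vert m a' v ≤ degree vert m a v + 1) ∧
      ∑ p ∈ Finset.Icc 1 m, a p ≤ 2 * ∑ p ∈ Finset.Icc 1 m, a' p := by
  obtain ⟨hB, h4, hsl, hpar, hsg⟩ := hI
  refine Spec.seq (Spec.mono (spec_insertAllCmd hB h4 rfl hsl hpar hτ he (by omega) hv
    fun p => (ha p).trans_lt (by omega)) le_rfl ?_)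
  rintro s₁ ⟨E, hB₁, h4₁, h11₁, hD, hS, -⟩
  refine Spec.seq (Spec.mono (spec_signAllCmd hB₁ h4₁ rfl rfl (by rw [h11₁]; exact hsg) hD hS hw hv)
    le_rfl ?_)
  rintro s₂ ⟨hB₂, h4₂, hp₂, -, -, hsl₂, hcl₂, hsg₂, hsr₂⟩
  have hsl₂' : ∀ v, s₂.mem 5 v = 0 := fun v => by
    rcases hsl₂ v with h | h
    · by_contra hne
      rw [h] at hne
      obtain ⟨m1, -, m3⟩ := hS.mem v hne
      have := hcl₂ _ (hD.two_le_of_mem _ m1) (by have := hD.le_of_mem _ m1; omega)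
      rw [m3, h] at this
      exact hne this
    · exact h
  refine Spec.mono (spec_halveAllCmd hB₂ h4₂ hp₂ hsl₂' rfl hsg₂ hD hw
    fun p => (Nat.add_le_add_right (ha p) 1).trans_lt hA) le_rfl ?_
  rintro s₃ ⟨hB₃, h5₃, hsl₃, h10₃, hpar₃, hsg₃, hsq₃, hsp₃, hva₃⟩
  have hval : ∀ p ∈ Finset.Icc 1 m, s₃.mem 4 p = halve a (s₃.mem 11) p := fun p hp => by
    rw [Finset.mem_Icc] at hp
    rw [hva₃, if_pos (by omega)]
  have hpar0 := hD.par_zero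
  have hcomp : s₁.paths.Compatible fun p => (-1) ^ s₃.mem 11 p := fun p hp => by
    have hp0 : 0 < p := Nat.pos_of_ne_zero fun h => hp (h ▸ hpar0)
    simp only
    rw [hsp₃ p hp0 hp, Paths.neg_one_pow_natDist]
  refine ⟨s₃.mem 4, ⟨hB₃, rfl, hsl₃, fun p => ?_, hsg₃⟩, fun p => ?_, fun v => ?_, ?_⟩
  · rw [hpar₃]
    split_ifs with h
    · rfl
    · rw [show p = 0 by omega, hpar0]
  · rw [hva₃]
    split_ifs
    · have := ha p
      unfold halve; omega
    · exact ha p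
  · have : degree vert m (s₃.mem 4) v = degree vert m (halve a (s₃.mem 11)) v :=
      Finset.sum_congr rfl fun p hp => by rw [hval p hp]
    rw [this]
    exact two_mul_degree_halve_le hD hS hsg₃ hcomp v
  · rw [Finset.sum_congr rfl hval]
    refine sum_le_two_mul_sum_halve hD hsg₃ hcomp fun h hh => ?_
    obtain ⟨k, hk, h1, h2⟩ := hsr₂ h hh (hcl₂ h (hD.two_le_of_mem h hh)
      (by have := hD.le_of_mem h hh; omega))
    exact ⟨k, hk, h1, by rw [hsq₃ _ (Or.inr (hD.par_root h hh)), h2]⟩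

end RealRAM

/-! ### The program: scaling, repeated rounds, and output -/

namespace RealRAM

variable {w m K : ℕ} {vert y : ℕ → ℕ} {S : ℝ} {s : Store} {τ : ℕ → ℤ} {a σ : ℕ → ℕ} {i : ℕ}

/-- Repeat the rounds, as often as `1` has to be doubled to exceed `m`. -/
def roundsCmd : Cmd :=
  .seq (.ops [.add 7 3 2]) (.loop (.word 7 6) (.seq roundCmd (.ops [.add 7 7 7])))

theorem two_pow_lt_succ_iff (j m : ℕ) : 2 ^ j < m + 1 ↔ j < m.size := by
  rw [Nat.lt_size]; omega

theorem two_pow_size_le (m : ℕ) : 2 ^ m.size ≤ 2 * m + 1 := by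
  rcases h : m.size with _ | j
  · simp
  · have := (two_pow_lt_succ_iff j m).2 (by omega)
    rw [pow_succ]; omega

theorem Rounding.spec_roundsCmd {A : ℕ} {B : ℕ → ℕ} (hI : Rounding m K vert y S a s)
    (hτ : ∀ v, τ v * τ v = 1)
    (he : ∀ i < m, τ (vert (2 * (i + 1))) * τ (vert (2 * (i + 1) + 1)) = -1)
    (hw : 2 * m + 2 < 2 ^ w) (hv : ∀ h, vert h < 2 ^ w) (ha : ∀ p, a p ≤ A) (hA1 : 1 ≤ A)
    (hA : A + 1 < 2 ^ w) (hB : ∀ v, degree vert m a v ≤ 2 ^ m.size * B v) :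
    Spec w roundsCmd (1 + (m.size * (roundCost m + 1 + 2) + 2)) s fun s' => ∃ a',
      Rounding m (2 ^ m.size) vert y S a' s' ∧ (∀ v, degree vert m a' v ≤ B v) ∧
      ∑ p ∈ Finset.Icc 1 m, a p ≤ 2 ^ m.size * ∑ p ∈ Finset.Icc 1 m, a' p := by
  let I : ℕ → Store → Prop := fun j s' => j ≤ m.size ∧ ∃ a', Rounding m (2 ^ j) vert y S a' s' ∧
    (∀ p, a' p ≤ A) ∧ (∀ v, degree vert m a' v ≤ 2 ^ (m.size - j) * B v) ∧
    ∑ p ∈ Finset.Icc 1 m, a p ≤ 2 ^ j * ∑ p ∈ Finset.Icc 1 m, a' p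
  refine Spec.seq (Spec.mono (spec_ops (Q := I 0) ?_) le_rfl fun s' h' => ?_)
  · obtain ⟨hb, h4, hsl, hpar, hsg⟩ := hI
    simp only [wpOps, Store.setReg, hb.reg2, hb.reg3]
    refine ⟨by omega, by omega, a, ⟨?_, h4, hsl, hpar, hsg⟩, ha, by simpa using hB, by simp⟩
    constructor <;> simp [hb.reg1, hb.reg2, hb.reg3, hb.reg4, hb.reg6, hb.mem3,
      hb.mem12, hb.rreg1]
  · refine Spec.mono (Spec.loop I h' ?_ ?_) le_rfl ?_
    · rintro j s ⟨-, a', hI, -⟩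
      simp only [Test.Holds, hI.base.reg6, hI.base.reg7]
      exact two_pow_lt_succ_iff j m
    · rintro j s hj ⟨-, a₁, hI, ha₁, hB₁, hs₁⟩
      refine Spec.seq (Spec.mono (hI.spec_roundCmd hτ he hw hv ha₁ hA1 hA) le_rfl ?_)
      rintro s₂ ⟨a₂, ⟨hb, h4, hsl, hpar, hsg⟩, ha₂, hB₂, hs₂⟩
      refine spec_ops ?_
      have h2j := (two_pow_lt_succ_iff j m).2 hj
      simp only [wpOps, Store.setReg, hb.reg7]
      refine ⟨by omega, hj, a₂, ⟨?_, h4, hsl, hpar, hsg⟩, ha₂, fun v => ?_, ?_⟩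
      · constructor <;> simp [hb.reg1, hb.reg2, hb.reg3, hb.reg4, hb.reg6, hb.mem3,
          hb.mem12, hb.rreg1, pow_succ, mul_two]
      · have h1 := hB₁ v
        have h2 := hB₂ v
        rw [show m.size - j = m.size - (j + 1) + 1 by omega, pow_succ, mul_right_comm] at h1
        omega
      · calc _ ≤ 2 ^ j * ∑ p ∈ Finset.Icc 1 m, a₁ p := hs₁
          _ ≤ 2 ^ j * (2 * ∑ p ∈ Finset.Icc 1 m, a₂ p) := Nat.mul_le_mul_left _ hs₂
          _ = _ := by rw [pow_succ]; ring
    · rintro s ⟨-, a', hI, -, hB', hs'⟩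
      exact ⟨a', hI, by simpa using hB', hs'⟩

/-- Multiply real register `0` by `2`, as often as `1` has to be doubled to exceed `m`. -/
def scaleCmd : Cmd := .loop (.word 7 6) (.ops [.add 7 7 7, .radd 0 0 0])

theorem spec_scaleCmd (h6 : s.reg 6 = m + 1) (h7 : s.reg 7 = 1) (hw : 2 * m < 2 ^ w) :
    Spec w scaleCmd (m.size * (2 + 2) + 2) s fun s' => s' =
      (s.setReg 7 (2 ^ m.size)).setRReg 0 (s.rreg 0 * 2 ^ m.size) := by
  refine Spec.loop (fun j s' => s' = (s.setReg 7 (2 ^ j)).setRReg 0 (s.rreg 0 * 2 ^ j)) ?_ ?_ ?_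
  · simp [Store.setReg, Store.setRReg, ← h7]
  · rintro j _ rfl
    simpa [Test.Holds, Store.setReg, Store.setRReg, h6] using two_pow_lt_succ_iff j m
  · rintro j _ hj rfl
    have := (two_pow_lt_succ_iff j m).2 hj
    refine spec_ops ?_
    simp only [wpOps, Store.setReg, Store.setRReg, Function.update_self, Function.update_idem]
    refine ⟨by omega, ?_⟩
    rw [pow_succ, mul_two, pow_succ]
    congr 2
    ring

/-- For the edge in register `5`, record the vertices of its two half-edges, add its value to real
register `1`, and split its value into the integral part and the scaled and rounded fractional
part. -/
def splitCmd : Cmd :=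
  .seq (.ops [.sub 8 5 3, .load 9 1 8, .add 10 5 5, .store 12 10 9, .load 9 2 8, .add 10 10 3,
    .store 12 10 9, .rload 0 0 8, .radd 1 1 0, .floor 9 0, .store 3 8 9, .cast 2 9, .rsub 0 0 2,
    .add 7 3 2]) <|
  .seq scaleCmd <|
  .ops [.floor 9 0, .store 4 5 9, .add 5 5 3]

/-- Set up the constants, and split all values. -/
def splitAllCmd : Cmd :=
  .seq (.ops [.const 2 0, .const 3 1, .const 4 2, .add 6 1 3, .add 5 3 2])
    (.loop (.word 5 6) splitCmd)

/-- The vertices of the half-edges of the first `j` edges, for the lists `t` and `u` of the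
endpoints of the edges. -/
def halfVertex (t u : ℕ → ℕ) (j h : ℕ) : ℕ :=
  if 2 ≤ h ∧ h < 2 * j + 2 then if h % 2 = 0 then t (h / 2 - 1) else u (h / 2 - 1) else 0

/-- The integral parts of the first `j` edge values. -/
noncomputable def intPart (x : ℕ → ℝ) (j e : ℕ) : ℕ := if e < j then ⌊x e⌋₊ else 0

/-- The fractional parts of the first `j` edge values, multiplied by `M` and rounded down. -/
noncomputable def scaledPart (x : ℕ → ℝ) (M j p : ℕ) : ℕ :=
  if 1 ≤ p ∧ p ≤ j then ⌊(x (p - 1) - ⌊x (p - 1)⌋₊) * M⌋₊ else 0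

theorem halfVertex_succ (t u : ℕ → ℕ) (j : ℕ) : halfVertex t u (j + 1) =
    Function.update (Function.update (halfVertex t u j) (2 * (j + 1)) (t j))
      (2 * (j + 1) + 1) (u j) := by
  funext h
  simp only [halfVertex, Function.update_apply]
  by_cases h1 : h = 2 * (j + 1) + 1
  · subst h1
    have e1 : (2 * (j + 1) + 1) / 2 - 1 = j := by omega
    have e2 : (2 * (j + 1) + 1) % 2 = 1 := by omega
    rw [if_pos (by omega), e2, e1]; simp
  · by_cases h2 : h = 2 * (j + 1)
    · subst h2
      have e1 : (2 * (j + 1)) / 2 - 1 = j := by omega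
      have e2 : (2 * (j + 1)) % 2 = 0 := by omega
      rw [if_pos (by omega), e2, e1]; simp
    · have : (2 ≤ h ∧ h < 2 * (j + 1) + 2) ↔ (2 ≤ h ∧ h < 2 * j + 2) := by omega
      simp [h1, h2, this]

theorem intPart_succ (x : ℕ → ℝ) (j : ℕ) :
    intPart x (j + 1) = Function.update (intPart x j) j ⌊x j⌋₊ := by
  funext e
  simp only [intPart, Function.update_apply]
  by_cases h : e = j
  · simp [h]
  · have : e < j + 1 ↔ e < j := by omega
    simp [h, this]

theorem scaledPart_succ (x : ℕ → ℝ) (M j : ℕ) : scaledPart x M (j + 1) =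
    Function.update (scaledPart x M j) (j + 1) ⌊(x j - ⌊x j⌋₊) * M⌋₊ := by
  funext p
  simp only [scaledPart, Function.update_apply]
  by_cases h : p = j + 1
  · simp [h]
  · have : p ≤ j + 1 ↔ p ≤ j := by omega
    simp [h, this]

theorem scaledPart_le (x : ℕ → ℝ) (M j p : ℕ) : scaledPart x M j p ≤ M := by
  unfold scaledPart
  split_ifs
  · refine Nat.floor_le_of_le (mul_le_of_le_one_left (by positivity) ?_)
    have := Nat.lt_floor_add_one (x (p - 1))
    linarith
  · simp

/-- The state when the values of the first `j` edges have been split. -/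
structure Splitting (m : ℕ) (t u : ℕ → ℕ) (x : ℕ → ℝ) (j : ℕ) (s : Store) : Prop where
  reg1 : s.reg 1 = m
  reg2 : s.reg 2 = 0
  reg3 : s.reg 3 = 1
  reg4 : s.reg 4 = 2
  reg5 : s.reg 5 = j + 1
  reg6 : s.reg 6 = m + 1
  mem1 : s.mem 1 = t
  mem2 : s.mem 2 = u
  mem3 : s.mem 3 = intPart x j
  mem4 : s.mem 4 = scaledPart x (2 ^ m.size) j
  mem5 : s.mem 5 = 0
  mem9 : s.mem 9 = 0
  mem11 : s.mem 11 = 0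
  mem12 : s.mem 12 = halfVertex t u j
  rreg1 : s.rreg 1 = ∑ e ∈ Finset.range j, x e
  rmem0 : s.rmem 0 = x

theorem Splitting.spec_splitCmd {t u : ℕ → ℕ} {x : ℕ → ℝ} {j : ℕ} (hI : Splitting m t u x j s)
    (hj : j < m) (hw : 2 * m + 2 < 2 ^ w) (ht : ∀ e, t e < 2 ^ w) (hu : ∀ e, u e < 2 ^ w)
    (hx : ∀ e, ⌊x e⌋₊ < 2 ^ w) :
    Spec w splitCmd (14 + (m.size * (2 + 2) + 2 + 3)) s (Splitting m t u x (j + 1)) := by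
  obtain ⟨h1, h2, h3, h4, h5, h6, m1, m2, m3, m4, m5, m9, m11, m12, r1, r0⟩ := hI
  refine Spec.seq (Spec.mono (spec_ops (Q := fun s' => s'.reg 6 = m + 1 ∧ s'.reg 7 = 1 ∧
    s'.rreg 0 = x j - ⌊x j⌋₊ ∧
    s'.reg 1 = m ∧ s'.reg 2 = 0 ∧ s'.reg 3 = 1 ∧ s'.reg 4 = 2 ∧ s'.reg 5 = j + 1 ∧
    s'.mem 1 = t ∧ s'.mem 2 = u ∧ s'.mem 3 = intPart x (j + 1) ∧
    s'.mem 4 = scaledPart x (2 ^ m.size) j ∧ s'.mem 5 = 0 ∧ s'.mem 9 = 0 ∧ s'.mem 11 = 0 ∧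
    s'.mem 12 = halfVertex t u (j + 1) ∧ s'.rreg 1 = ∑ e ∈ Finset.range (j + 1), x e ∧
    s'.rmem 0 = x) ?_) le_rfl ?_)
  · simp only [wpOps, Store.setReg, Store.setMem, Store.setRReg, State.setEntry,
      Function.update_self, ne_eq, Nat.reduceEqDiff, not_false_eq_true, OfNat.one_ne_ofNat,
      OfNat.zero_ne_ofNat, one_ne_zero, zero_ne_one,
      Function.update_of_ne, h1, h2, h3, h4, h5, h6, m1, m2, m3, m4, m5, m9, m11, m12, r1, r0,
      Nat.add_sub_cancel]
    refine ⟨by omega, ht _, by omega, hu _, by omega, hx _, by omega, trivial, trivial, trivial,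
      trivial, trivial, trivial, trivial, trivial, trivial, trivial, ?_, trivial, trivial, trivial,
      trivial, ?_, ?_, trivial⟩
    · rw [intPart_succ]
    · rw [halfVertex_succ, two_mul]
    · rw [Finset.sum_range_succ]
  · rintro s' ⟨h6, h7, r0', h1, h2, h3, h4, h5, m1, m2, m3, m4, m5, m9, m11, m12, r1, r0⟩
    refine Spec.seq (Spec.mono (spec_scaleCmd h6 h7 (by omega)) le_rfl ?_)
    rintro _ rfl
    have hsc := scaledPart_le x (2 ^ m.size) (j + 1) (j + 1)
    have hsz := two_pow_size_le m
    have e := congrFun (scaledPart_succ x (2 ^ m.size) j) (j + 1)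
    rw [Function.update_self, Nat.cast_pow, Nat.cast_ofNat] at e
    rw [e] at hsc
    refine spec_ops ?_
    simp only [wpOps, Store.setReg, Store.setMem, Store.setRReg, State.setEntry,
      Function.update_self, ne_eq, Nat.reduceEqDiff, not_false_eq_true,
      Function.update_of_ne, h3, h5, m4, r0']
    refine ⟨by omega, by omega, ?_⟩
    constructor
    case mem4 => rw [scaledPart_succ]; simp
    all_goals simp [h1, h2, h3, h4, h6, m1, m2, m3, m5, m9, m11, m12, r1, r0]

theorem spec_splitAllCmd {t u : ℕ → ℕ} {x : ℕ → ℝ} (h1 : s.reg 1 = m) (m1 : s.mem 1 = t)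
    (m2 : s.mem 2 = u) (hm : ∀ A, 3 ≤ A → s.mem A = 0) (r0 : s.rmem 0 = x) (r1 : s.rreg 1 = 0)
    (hw : 2 * m + 2 < 2 ^ w) (ht : ∀ e, t e < 2 ^ w) (hu : ∀ e, u e < 2 ^ w)
    (hx : ∀ e, ⌊x e⌋₊ < 2 ^ w) :
    Spec w splitAllCmd (5 + (m * (14 + (m.size * (2 + 2) + 2 + 3) + 2) + 2)) s
      (Splitting m t u x m) := by
  refine Spec.seq (Spec.mono (spec_ops (Q := Splitting m t u x 0) ?_) le_rfl ?_)
  · simp only [wpOps, Store.setReg, Function.update_self, ne_eq, Nat.reduceEqDiff,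
      not_false_eq_true, OfNat.one_ne_ofNat, Function.update_of_ne, h1]
    refine ⟨by omega, by omega, by omega, by omega, by omega, ?_⟩
    have e1 : intPart x 0 = 0 := by funext e; simp [intPart]
    have e2 : scaledPart x (2 ^ m.size) 0 = 0 := by
      funext p; simp only [scaledPart, Pi.zero_apply]; rw [if_neg (by omega)]
    have e3 : halfVertex t u 0 = 0 := by
      funext p; simp only [halfVertex, Pi.zero_apply]; rw [if_neg (by omega)]
    constructor <;> simp [h1, m1, m2, hm, r0, r1, e1, e2, e3]
  · intro s' h'
    refine Spec.loop (fun j s' => Splitting m t u x j s') h' ?_ ?_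
    · intro j s hI
      simp only [Test.Holds, hI.reg5, hI.reg6]
      omega
    · intro j s hj hI
      exact hI.spec_splitCmd hj hw ht hu hx

/-- For the edge in register `5`, add the rounded fractional part to the integral part, as long as
the sum of all the results does not exceed the bound whose unused part is in real register `1`. -/
def mergeCmd : Cmd :=
  .seq (.ops [.sub 8 5 3, .load 9 3 8, .load 10 4 5, .add 9 9 10, .cast 0 9]) <|
  .seq (.ite (.real 1 0) (.ops [.floor 9 1, .cast 0 9]) (.ops [])) <|
  .ops [.store 3 8 9, .rsub 1 1 0, .add 5 5 3]

/-- Write the result. -/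
def mergeAllCmd : Cmd := .seq (.ops [.add 5 3 2]) (.loop (.word 5 6) mergeCmd)

/-- The state when the results for the first `j` edges have been written. -/
structure Merging (m : ℕ) (y a : ℕ → ℕ) (S : ℝ) (j : ℕ) (s : Store) : Prop where
  reg2 : s.reg 2 = 0
  reg3 : s.reg 3 = 1
  reg5 : s.reg 5 = j + 1
  reg6 : s.reg 6 = m + 1
  mem4 : s.mem 4 = a
  rest : ∀ e, j ≤ e → s.mem 3 e = y e
  le : ∀ e < j, s.mem 3 e ≤ y e + a (e + 1)
  rreg1 : s.rreg 1 = S - ∑ e ∈ Finset.range j, (s.mem 3 e : ℝ)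
  nonneg : 0 ≤ s.rreg 1
  lt_one_or : s.rreg 1 < 1 ∨ ∀ e < j, s.mem 3 e = y e + a (e + 1)

theorem Merging.wp_mergeCmd {j : ℕ} (hI : Merging m y a S j s) (hj : j < m)
    (hw : 2 * m + 2 < 2 ^ w) (hya : ∀ e < m, y e + a (e + 1) < 2 ^ w) :
    wp w mergeCmd (Merging m y a S (j + 1)) s := by
  obtain ⟨h2, h3, h5, h6, m4, m3, hle, r1, hr, hor⟩ := hI
  have hyj := hya j hj
  have m3j := m3 j le_rfl
  simp only [mergeCmd, wp, wpOps, Store.setReg, Store.setMem, Store.setRReg, State.setEntry,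
    Test.Holds, Function.update_self, ne_eq, Nat.reduceEqDiff, not_false_eq_true,
    one_ne_zero, Function.update_of_ne, h3, h5, m4, m3j, Nat.add_sub_cancel]
  have hsum : ∀ z : ℕ, ∑ e ∈ Finset.range (j + 1), (Function.update (s.mem 3) j z e : ℝ) =
      ∑ e ∈ Finset.range j, (s.mem 3 e : ℝ) + z := fun z => by
    rw [Finset.sum_range_succ, Function.update_self]
    congr 1
    refine Finset.sum_congr rfl fun e he => ?_
    rw [Function.update_of_ne (Finset.mem_range.1 he).ne]
  -- the common part of the two cases: any new entry that fits into the unused part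
  have key : ∀ (z : ℕ) (s' : Store), z ≤ y j + a (j + 1) → (z : ℝ) ≤ s.rreg 1 →
      (s.rreg 1 - z < 1 ∨ z = y j + a (j + 1)) → s'.reg 2 = 0 → s'.reg 3 = 1 →
      s'.reg 5 = j + 1 + 1 → s'.reg 6 = m + 1 → s'.mem 4 = a →
      s'.mem 3 = Function.update (s.mem 3) j z → s'.rreg 1 = s.rreg 1 - z →
      Merging m y a S (j + 1) s' := by
    intro z s' hz1 hz2 hz3 h2' h3' h5' h6' m4' m3' r1'
    have hval : ∀ e, e ≠ j → s'.mem 3 e = s.mem 3 e := fun e he => by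
      rw [m3', Function.update_of_ne he]
    have hvalj : s'.mem 3 j = z := by rw [m3', Function.update_self]
    constructor
    case reg2 => exact h2'
    case reg3 => exact h3'
    case reg5 => exact h5'
    case reg6 => exact h6'
    case mem4 => exact m4'
    case rest =>
      intro e he
      rw [hval e (by omega)]
      exact m3 e (by omega)
    case le =>
      intro e he
      by_cases hej : e = j
      · subst hej; rw [hvalj]; exact hz1
      · rw [hval e hej]; exact hle e (by omega)
    case rreg1 => rw [r1', m3', hsum, r1]; ring
    case nonneg => rw [r1']; linarith
    case lt_one_or =>
      rw [r1']
      rcases hz3 with hz3 | hz3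
      · exact Or.inl hz3
      · rcases hor with hor | hor
        · left
          have : (0 : ℝ) ≤ z := by positivity
          linarith
        · right
          intro e he
          by_cases hej : e = j
          · subst hej; rw [hvalj]; exact hz3
          · rw [hval e hej]; exact hor e (by omega)
  refine ⟨by omega, by omega, by omega, by omega, fun hlt => ?_, fun hlt => ⟨by omega, ?_⟩⟩
  · have hfl : ⌊s.rreg 1⌋₊ ≤ y j + a (j + 1) := Nat.floor_le_of_le hlt.le
    refine ⟨by omega, by omega, key ⌊s.rreg 1⌋₊ _ hfl (Nat.floor_le hr) (Or.inl ?_) ?_ ?_ ?_ ?_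
      ?_ ?_ ?_⟩
    · have := Nat.lt_floor_add_one (s.rreg 1); linarith
    all_goals simp [h2, h3, h6, m4]
  · refine key (y j + a (j + 1)) _ le_rfl (not_lt.1 hlt) (Or.inr rfl) ?_ ?_ ?_ ?_ ?_ ?_ ?_
    all_goals simp [h2, h3, h6, m4]

theorem spec_mergeAllCmd (hB : Base m K vert y S s) (h4 : s.mem 4 = a) (hS : 0 ≤ S)
    (hw : 2 * m + 2 < 2 ^ w) (hya : ∀ e < m, y e + a (e + 1) < 2 ^ w) :
    Spec w mergeAllCmd (1 + (m * (mergeCmd.cost + 2) + 2)) s (Merging m y a S m) := by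
  refine Spec.seq (Spec.mono (spec_ops (Q := Merging m y a S 0) ?_) le_rfl ?_)
  · simp only [wpOps, Store.setReg, hB.reg2, hB.reg3]
    refine ⟨by omega, ?_⟩
    constructor <;> simp [hB.reg2, hB.reg3, hB.reg6, hB.mem3, hB.rreg1, h4, hS]
  · intro s' h'
    refine Spec.loop (fun j s' => Merging m y a S j s') h' ?_ ?_
    · intro j s hI
      simp only [Test.Holds, hI.reg5, hI.reg6]
      omega
    · intro j s hj hI
      exact spec_of_wp (hI.wp_mergeCmd hj hw hya)

theorem Merging.sum_eq (hI : Merging m y a S m s)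
    (hS : ⌊S⌋₊ ≤ ∑ e ∈ Finset.range m, (y e + a (e + 1))) (hS0 : 0 ≤ S) :
    ∑ e ∈ Finset.range m, s.mem 3 e = ⌊S⌋₊ := by
  have h1 := hI.rreg1
  have h2 := hI.nonneg
  rw [← Nat.cast_sum] at h1
  have hle : ∑ e ∈ Finset.range m, s.mem 3 e ≤ ⌊S⌋₊ := Nat.le_floor (by linarith)
  rcases hI.lt_one_or with h | h
  · refine ((Nat.floor_eq_iff hS0).2 ⟨by linarith, by linarith⟩).symm
  · refine le_antisymm hle (hS.trans (Finset.sum_le_sum fun e he => ?_))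
    exact (h e (Finset.mem_range.1 he)).ge

end RealRAM

/-! ### Graphs, correctness and running time -/

namespace RealRAM

theorem sum_Icc_one (m : ℕ) {M : Type*} [AddCommMonoid M] (F : ℕ → M) :
    ∑ p ∈ Finset.Icc 1 m, F p = ∑ e ∈ Finset.range m, F (e + 1) := by
  induction m with
  | zero => simp
  | succ m ih => rw [Finset.sum_Icc_succ_top (by omega), Finset.sum_range_succ, ih]

theorem halfVertex_even {t u : ℕ → ℕ} {m e : ℕ} (he : e < m) :
    halfVertex t u m (2 * (e + 1)) = t e := by
  have e1 : (2 * (e + 1)) / 2 - 1 = e := by omega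
  have e2 : (2 * (e + 1)) % 2 = 0 := by omega
  rw [halfVertex, if_pos (by omega), if_pos e2, e1]

theorem halfVertex_odd {t u : ℕ → ℕ} {m e : ℕ} (he : e < m) :
    halfVertex t u m (2 * (e + 1) + 1) = u e := by
  have e1 : (2 * (e + 1) + 1) / 2 - 1 = e := by omega
  have e2 : ¬ (2 * (e + 1) + 1) % 2 = 0 := by omega
  rw [halfVertex, if_pos (by omega), if_neg e2, e1]

theorem toArray_fin {α : Type} [Zero α] {k : ℕ} (f : Fin k → α) (i : Fin k) :
    toArray f i = f i := by simp [toArray]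

variable {n m : ℕ} {G : EdgeGraph n m}

/-- The vertices of the half-edges of a graph. -/
def halves (G : EdgeGraph n m) : ℕ → ℕ :=
  halfVertex (toArray fun e => (G.tail e : ℕ)) (toArray fun e => (G.head e : ℕ)) m

theorem halves_even (e : Fin m) : halves G (2 * (e + 1)) = G.tail e := by
  rw [halves, halfVertex_even e.2, toArray_fin fun e => (G.tail e : ℕ)]

theorem halves_odd (e : Fin m) : halves G (2 * (e + 1) + 1) = G.head e := by
  rw [halves, halfVertex_odd e.2, toArray_fin fun e => (G.head e : ℕ)]

theorem tail_ne_head (hG : G.IsBipartite) (e : Fin m) : G.tail e ≠ G.head e := by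
  obtain ⟨P, hP⟩ := hG
  intro h
  have := hP e
  rw [h] at this
  tauto

theorem degree_halves (hG : G.IsBipartite) (a : ℕ → ℕ) (v : Fin n) :
    degree (halves G) m a v = ∑ e ∈ G.incident v, a (e + 1) := by
  rw [degree, sum_Icc_one, Finset.sum_range, EdgeGraph.incident, Finset.sum_filter]
  refine Finset.sum_congr rfl fun e _ => ?_
  rw [halves_even, halves_odd]
  have := tail_ne_head hG e
  simp only [Fin.val_inj]
  grind

theorem degree_halves_of_le (a : ℕ → ℕ) {v : ℕ} (hv : n ≤ v) : degree (halves G) m a v = 0 := by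
  rw [degree, sum_Icc_one, Finset.sum_range]
  refine Finset.sum_eq_zero fun e _ => ?_
  rw [halves_even, halves_odd]
  have h1 := (G.tail e).2
  have h2 := (G.head e).2
  rw [if_neg (by omega), if_neg (by omega)]; simp

theorem exists_side (hG : G.IsBipartite) : ∃ τ : ℕ → ℤ, (∀ v, τ v * τ v = 1) ∧
    ∀ i < m, τ (halves G (2 * (i + 1))) * τ (halves G (2 * (i + 1) + 1)) = -1 := by
  classical
  obtain ⟨P, hP⟩ := hG
  refine ⟨fun v => if ∃ u ∈ P, (u : ℕ) = v then 1 else -1, fun v => ?_, fun i hi => ?_⟩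
  · dsimp only; split_ifs <;> norm_num
  · have h1 := halves_even (G := G) ⟨i, hi⟩
    have h2 := halves_odd (G := G) ⟨i, hi⟩
    simp only at h1 h2
    rw [h1, h2]
    have e : ∀ v : Fin n, (∃ u ∈ P, (u : ℕ) = v) ↔ v ∈ P := fun v => by
      simp [Fin.val_inj]
    simp only [e]
    rcases hP ⟨i, hi⟩ with h | h <;> simp [h]

theorem mem_incident_tail (e : Fin m) : e ∈ G.incident (G.tail e) := by simp [EdgeGraph.incident]

variable {b : Fin n → ℕ} {x : Fin m → ℝ}

theorem sum_floor_le (hx : G.IsFractionalBMatching b x) (v : Fin n) :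
    ∑ e ∈ G.incident v, ⌊x e⌋₊ ≤ b v := by
  have : ∑ e ∈ G.incident v, (⌊x e⌋₊ : ℝ) ≤ b v :=
    (Finset.sum_le_sum fun e _ => Nat.floor_le (hx.1 e)).trans (hx.2 v)
  exact_mod_cast this

theorem floor_le_demand (hx : G.IsFractionalBMatching b x) (e : Fin m) :
    ⌊x e⌋₊ ≤ b (G.tail e) :=
  (Finset.single_le_sum (f := fun e => ⌊x e⌋₊) (fun _ _ => Nat.zero_le _)
    (mem_incident_tail e)).trans (sum_floor_le hx _)

/-- The demand that remains for the fractional parts of the edge values. -/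
noncomputable def restDemand (G : EdgeGraph n m) (b : Fin n → ℕ) (x : Fin m → ℝ) (v : ℕ) : ℕ :=
  if h : v < n then b ⟨v, h⟩ - ∑ e ∈ G.incident ⟨v, h⟩, ⌊x e⌋₊ else 0

theorem restDemand_fin (v : Fin n) :
    restDemand G b x v = b v - ∑ e ∈ G.incident v, ⌊x e⌋₊ := by simp [restDemand]

theorem scaledPart_fin (M : ℕ) (e : Fin m) :
    scaledPart (toArray x) M m (e + 1) = ⌊(x e - ⌊x e⌋₊) * M⌋₊ := by
  rw [scaledPart, if_pos (by have := e.2; omega), Nat.add_sub_cancel, toArray_fin]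

theorem intPart_fin (e : Fin m) : intPart (toArray x) m e = ⌊x e⌋₊ := by
  rw [intPart, if_pos e.2, toArray_fin]

theorem degree_scaledPart_le (hG : G.IsBipartite) (hx : G.IsFractionalBMatching b x) (M v : ℕ) :
    degree (halves G) m (scaledPart (toArray x) M m) v ≤ M * restDemand G b x v := by
  by_cases hv : v < n
  · lift v to Fin n using hv
    rw [degree_halves hG, restDemand_fin, ← Nat.cast_le (α := ℝ), Nat.cast_mul,
      Nat.cast_sub (sum_floor_le hx v)]
    simp only [scaledPart_fin]
    push_cast
    calc ∑ e ∈ G.incident v, (⌊(x e - ⌊x e⌋₊) * M⌋₊ : ℝ)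
        ≤ ∑ e ∈ G.incident v, (x e - ⌊x e⌋₊) * M := Finset.sum_le_sum fun e _ =>
          Nat.floor_le (mul_nonneg (sub_nonneg.2 (Nat.floor_le (hx.1 e))) (Nat.cast_nonneg _))
      _ = M * (∑ e ∈ G.incident v, x e - ∑ e ∈ G.incident v, (⌊x e⌋₊ : ℝ)) := by
          rw [← Finset.sum_mul, Finset.sum_sub_distrib, mul_comm]
      _ ≤ _ := mul_le_mul_of_nonneg_left (sub_le_sub_right (hx.2 v) _) (Nat.cast_nonneg _)
  · rw [degree_halves_of_le _ (not_lt.1 hv)]; omega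

/-- Values `a` that do not exceed the remaining demands complete the integral parts to an integral
`b`-matching. -/
theorem sum_floor_add_le (hG : G.IsBipartite) (hx : G.IsFractionalBMatching b x) {a : ℕ → ℕ}
    (ha : ∀ v, degree (halves G) m a v ≤ restDemand G b x v) (v : Fin n) :
    ∑ e ∈ G.incident v, (⌊x e⌋₊ + a (e + 1)) ≤ b v := by
  have h1 := ha v
  rw [degree_halves hG, restDemand_fin] at h1
  have h2 := sum_floor_le hx v
  rw [Finset.sum_add_distrib]
  omega

/-- The loss by the rounding of the scaled fractional parts is less than `1` in total, because the
scale `M` exceeds the number of edges. -/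
theorem floor_sum_le (hx : ∀ e, 0 ≤ x e) {a : ℕ → ℕ} {M : ℕ} (hM : m < M)
    (ha : ∑ p ∈ Finset.Icc 1 m, scaledPart (toArray x) M m p ≤ M * ∑ p ∈ Finset.Icc 1 m, a p) :
    ⌊∑ e, x e⌋₊ ≤ ∑ e : Fin m, (⌊x e⌋₊ + a (e + 1)) := by
  rw [sum_Icc_one, sum_Icc_one, Finset.sum_range, Finset.sum_range] at ha
  simp only [scaledPart_fin] at ha
  rw [← Nat.cast_le (α := ℝ)] at ha
  push_cast at ha
  have h1 : ∑ e, ((x e - ⌊x e⌋₊) * M - 1) ≤ ∑ e, (⌊(x e - ⌊x e⌋₊) * M⌋₊ : ℝ) :=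
    Finset.sum_le_sum fun e _ => by
      have := Nat.lt_floor_add_one ((x e - ⌊x e⌋₊) * M)
      linarith
  rw [Finset.sum_sub_distrib, ← Finset.sum_mul, Finset.sum_sub_distrib] at h1
  simp only [Finset.sum_const, Finset.card_univ, Fintype.card_fin, nsmul_eq_mul, mul_one] at h1
  have hM' : (m : ℝ) < M := by exact_mod_cast hM
  have h2 : (∑ e, x e - ∑ e, (⌊x e⌋₊ : ℝ) - 1) < ∑ e : Fin m, (a (e + 1) : ℝ) := by
    by_contra hcon
    have h3 := mul_le_mul_of_nonneg_left (not_lt.1 hcon) (Nat.cast_nonneg (α := ℝ) M)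
    nlinarith
  refine Nat.lt_succ_iff.1 ((Nat.floor_lt (Finset.sum_nonneg fun e _ => hx e)).2 ?_)
  rw [Finset.sum_add_distrib]
  push_cast
  linarith

/-- The whole algorithm. -/
def mainCmd : Cmd := .seq splitAllCmd <| .seq roundsCmd mergeAllCmd

/-- A bound on the number of steps of the algorithm. -/
def mainCost (m : ℕ) : ℕ :=
  5 + (m * (14 + (m.size * (2 + 2) + 2 + 3) + 2) + 2) +
    (1 + (m.size * (roundCost m + 1 + 2) + 2) + (1 + (m * (mergeCmd.cost + 2) + 2)))

theorem spec_mainCmd (hG : G.IsBipartite) (hx : G.IsFractionalBMatching b x) {w : ℕ}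
    (hw : (n + m + 2) ^ 2 ≤ 2 ^ w) (hb : ∀ v, b v < 2 ^ w) {s : Store}
    (hs : s.atLine 0 = input G b x) :
    Spec w mainCmd (mainCost m) s fun s' => ∃ y : Fin m → ℕ, (∀ e : Fin m, s'.mem 3 e = y e) ∧
      G.IsBMatching b y ∧ ∑ e, y e = ⌊∑ e, x e⌋₊ := by
  have hreg : s.reg = (input G b x).reg := congrArg State.reg hs
  have hrreg : s.rreg = (input G b x).rreg := congrArg State.rreg hs
  have hmem : s.mem = (input G b x).mem := congrArg State.mem hs
  have hrmem : s.rmem = (input G b x).rmem := congrArg State.rmem hs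
  have hwm : 2 * m + 2 < 2 ^ w := by
    nlinarith [Nat.zero_le (n * n), Nat.zero_le (n * m), Nat.zero_le (m * m)]
  have hwn : n < 2 ^ w := by
    nlinarith [Nat.zero_le (n * n), Nat.zero_le (n * m), Nat.zero_le (m * m)]
  have ht : ∀ e, toArray (fun e => (G.tail e : ℕ)) e < 2 ^ w := fun e => by
    unfold toArray
    split_ifs
    · exact (G.tail _).2.trans hwn
    · omega
  have hu : ∀ e, toArray (fun e => (G.head e : ℕ)) e < 2 ^ w := fun e => by
    unfold toArray
    split_ifs
    · exact (G.head _).2.trans hwn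
    · omega
  have hxw : ∀ e, ⌊toArray x e⌋₊ < 2 ^ w := fun e => by
    unfold toArray
    split_ifs
    · exact (floor_le_demand hx _).trans_lt (hb _)
    · simp
  obtain ⟨τ, hτ, he⟩ := exists_side hG
  refine Spec.seq (Spec.mono (spec_splitAllCmd (m := m) (t := toArray fun e => (G.tail e : ℕ))
    (u := toArray fun e => (G.head e : ℕ)) (x := toArray x) (by simp [hreg, input])
    (by simp [hmem, input]) (by simp [hmem, input]) ?_ (by simp [hrmem, input])
    (by simp [hrreg, input]) hwm ht hu hxw) le_rfl ?_)
  · intro A hA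
    have h0 : A ≠ 0 := by omega
    have h1 : A ≠ 1 := by omega
    have h2 : A ≠ 2 := by omega
    simp only [hmem, input, h0, h1, h2, if_false]
    rfl
  intro s₁ hI
  have hsz := two_pow_size_le m
  have hv : ∀ h, halves G h < 2 ^ w := fun h => by
    unfold halves halfVertex
    split_ifs
    · exact ht _
    · exact hu _
    · omega
  have hR : Rounding m (s₁.reg 7) (halves G) (intPart (toArray x) m) (∑ e, x e)
      (scaledPart (toArray x) (2 ^ m.size) m) s₁ := by
    refine ⟨⟨hI.reg1, hI.reg2, hI.reg3, hI.reg4, hI.reg6, rfl, hI.mem3, hI.mem12, ?_⟩, hI.mem4,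
      congrFun hI.mem5, congrFun hI.mem9, fun p => ?_⟩
    · rw [hI.rreg1, Finset.sum_range]
      exact Finset.sum_congr rfl fun e _ => toArray_fin x e
    · rw [hI.mem11]; exact Nat.zero_le _
  refine Spec.seq (Spec.mono (hR.spec_roundsCmd hτ he hwm hv (A := 2 ^ m.size)
    (fun p => scaledPart_le _ _ _ p) Nat.one_le_two_pow (by omega)
    (degree_scaledPart_le hG hx _)) le_rfl ?_)
  rintro s₂ ⟨a, ⟨hB, h4, -⟩, ha, hsum⟩
  have hmatch := sum_floor_add_le hG hx ha
  have hSnn : 0 ≤ ∑ e, x e := Finset.sum_nonneg fun e _ => hx.1 e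
  refine Spec.mono (spec_mergeAllCmd hB h4 hSnn hwm fun e he => ?_) le_rfl ?_
  · have h1 := intPart_fin (x := x) ⟨e, he⟩
    simp only at h1
    rw [h1]
    refine ((Finset.single_le_sum (f := fun e : Fin m => ⌊x e⌋₊ + a (e + 1))
      (fun _ _ => Nat.zero_le _) (mem_incident_tail ⟨e, he⟩)).trans (hmatch _)).trans_lt (hb _)
  · intro s₃ hM
    have hle : ∀ e : Fin m, s₃.mem 3 e ≤ ⌊x e⌋₊ + a (e + 1) := fun e => by
      have := hM.le e e.2
      rwa [intPart_fin] at this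
    refine ⟨fun e => s₃.mem 3 e, fun e => rfl, fun v =>
      (Finset.sum_le_sum fun e _ => hle e).trans (hmatch v), ?_⟩
    rw [← Finset.sum_range fun e => s₃.mem 3 e]
    refine hM.sum_eq ?_ hSnn
    rw [Finset.sum_range]
    simp only [intPart_fin]
    exact floor_sum_le hx.1 (Nat.lt_size_self m) hsum

theorem mainCost_le (m : ℕ) : mainCost m ≤ 1000 * ((m + 1) * (m.size + 1)) := by
  simp only [mainCost, roundCost, insertCmd, attachCmd, signCmd, halveCmd, mergeCmd, Cmd.cost,
    List.length_cons, List.length_nil]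
  norm_num
  generalize m.size = L
  nlinarith [Nat.zero_le (m * L)]

theorem isNearlyLinear_mainCost : IsNearlyLinear mainCost := by
  refine ⟨1, Asymptotics.IsBigO.of_bound 8000 ?_⟩
  filter_upwards [Filter.eventually_ge_atTop 3] with m hm
  have hm' : (3 : ℝ) ≤ m := by exact_mod_cast hm
  have hlog : 1 ≤ Real.log m := by
    rw [Real.le_log_iff_exp_le (by linarith)]
    exact (Real.exp_one_lt_three).le.trans hm'
  have hsize : (m.size : ℝ) ≤ 2 * Real.log m + 1 := by
    obtain ⟨L, hL⟩ : ∃ L, m.size = L + 1 := ⟨m.size - 1, by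
      have := Nat.size_pos.2 (show 0 < m by omega); omega⟩
    have h1 : 2 ^ L ≤ m := Nat.lt_size.1 (by omega)
    have h2 : (2 : ℝ) ^ L ≤ m := by exact_mod_cast h1
    have h3 := Real.log_le_log (by positivity) h2
    rw [Real.log_pow] at h3
    have h4 := Real.log_two_gt_d9
    have h5 : (0 : ℝ) ≤ L := by positivity
    rw [hL]; push_cast
    nlinarith
  have h := mainCost_le m
  have h' : (mainCost m : ℝ) ≤ 1000 * ((m + 1) * (m.size + 1)) := by exact_mod_cast h
  rw [Real.norm_of_nonneg (by positivity), Real.norm_of_nonneg (by positivity), pow_one]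
  have h6 : ((m : ℝ) + 1) * (m.size + 1) ≤ (2 * m) * (4 * Real.log m) :=
    mul_le_mul (by linarith) (by linarith) (by positivity) (by positivity)
  linarith

end RealRAM

theorem theorem6 :
    ∃ (prog : RealRAM.Program) (κ : ℕ) (T : ℕ → ℕ), IsNearlyLinear T ∧
      ∀ (n m : ℕ) (G : EdgeGraph n m), G.IsBipartite →
      ∀ (b : Fin n → ℕ) (x : Fin m → ℝ), G.IsFractionalBMatching b x →
      ∀ w : ℕ, (n + m + 2) ^ κ ≤ 2 ^ w → (∀ v, b v < 2 ^ w) →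
        ∃ t ≤ T m, ∃ s : RealRAM.State,
          RealRAM.run w prog t (RealRAM.input G b x) = some s ∧
          RealRAM.Halted prog s ∧
          ∃ y : Fin m → ℕ, RealRAM.Outputs s y ∧ G.IsBMatching b y ∧
            ∑ e, y e = ⌊∑ e, x e⌋₊ := by
  refine ⟨RealRAM.mainCmd.compile 0 ++ [.halt], 2, RealRAM.mainCost,
    RealRAM.isNearlyLinear_mainCost, fun n m G hG b x hx w hw hb => ?_⟩
  let s : RealRAM.Store := ⟨(RealRAM.input G b x).reg, (RealRAM.input G b x).rreg,
    (RealRAM.input G b x).mem, (RealRAM.input G b x).rmem⟩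
  obtain ⟨t, ht, s', ⟨y, hy, hby, hsum⟩, hrun⟩ :=
    RealRAM.spec_mainCmd hG hx hw hb (s := s) rfl
  refine ⟨t, ht, s'.atLine (0 + RealRAM.mainCmd.len), hrun [] [.halt], ?_, y, hy, hby, hsum⟩
  simp [RealRAM.Halted, RealRAM.Store.atLine, RealRAM.Cmd.length_compile]
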